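/- **Setting.** A seller sells $k\ge 1$ items in $k$ periods to one buyer. The values $v_1,\dots,v_k$ are independent, and $v_i$ is drawn from a distribution $\mu_i$ on $[\underline v_i,\bar v_i]$ that has a density and whose support contains $\underline v_i$. A (direct) mechanism $(x,p)$ consists of measurable functions $x_i(v_{\le i})\in[0,1]$ (allocation probabilities) and $p_i(v_{\le i})\in\mathbb R$ (payments), $1\le i\le k$, of the history of reports $v_{\le i}=(v_1,\dots,v_i)$, such that the expected payments, initially and conditionally on every history, are finite. Put $U_i(v_{\le i})=\mathbb E_{v_{i+1},\dots,v_k}\big[\sum_{j>i}(v_jx_j(v_{\le j})-p_j(v_{\le j}))\big]$. The mechanism is *feasible* if for all $i$, $v_{\le i}$ and $v_i'\in[\underline v_i,\bar v_i]$ - (periodic IC) $v_ix_i(v_{\le i})-p_i(v_{\le i})+U_i(v_{\le i})\ \ge\ v_ix_i(v_{<i},v_i')-p_i(v_{<i},v_i')+U_i(v_{<i},v_i')$, and - (stage-wise ex-post IR) $v_ix_i(v_{\le i})-p_i(v_{\le i})\ge 0$. It is *optimal* if it is feasible and its revenue $\mathbb E[\sum_i p_i(v_{\le i})]$ is maximal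 among all feasible mechanisms. **Tight surplus-utility-tradeoff problem.** For a distribution $\mu$ on $[\underline v,\bar v]$, $c\in\mathbb R$ and $g:\mathbb R\to[-\infty,\infty)$: maximize $\mathbb E_{v\sim\mu}\big[v\,x(v)+g(v\,x(v)-p(v))\big]$ over all $x:[\underline v,\bar v]\to[0,1]$, $p:[\underline v,\bar v]\to\mathbb R$ with $v\,x(v)-p(v)\ge v\,x(v')-p(v')$ for all $v,v'$ and $\mathbb E_{v\sim\mu}[v\,x(v)-p(v)]=c$. **Cumulative tradeoff functions.** Let $\hat g_{k+1}(u)=0$ for $u\ge0$ and $\hat g_{k+1}(u)=-\infty$ for $u<0$. For $i=k,k-1,\dots,1$ let $\hat g_i(c)$ be the value (supremum) of the tight problem for $\mu_i$, $c$ and the tradeoff function $g=\hat g_{i+1}$ if $i\ge2$, respectively $g(u)=\hat g_2(u)-u$ if $i=1$. **Theorem 3.1.** 1. For all $i$ and all $c\in\mathbb R$ the tight problem that defines $\hat g_i(c)$ has an optimal solution $(X_i^c,P_i^c)$, and these solutions can be chosen so that $(c,v)\mapsto X_i^c(v)$ and $(c,v)\mapsto P_i^c(v)$ are measurable. 2.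 The function $\hat g_1$ has a maximizer $c_0\in\mathbb R$. 3. For every choice of optimal solutions $(X_i^c,P_i^c)$ as in 1 and every maximizer $c_0$ of $\hat g_1$, the following mechanism is optimal: on each day $i=1,\dots,k$, if the buyer reports $v_i$, he is allocated the item with probability $X_i^{c_{i-1}}(v_i)$, pays $v_iX_i^{c_{i-1}}(v_i)$ if $i<k$ and $P_i^{c_{i-1}}(v_i)$ if $i=k$, and the scalar state is updated to $c_i=v_iX_i^{c_{i-1}}(v_i)-P_i^{c_{i-1}}(v_i)$. -/

import Mathlib

open MeasureTheory

noncomputable section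

/-- Expectation of an extended-real function: the integral of the positive part minus the integral
of the negative part, with `∞ - ∞ = -∞`. -/
def extExp {α : Type*} [MeasurableSpace α] (μ : Measure α) (h : α → EReal) : EReal :=
  ((∫⁻ a, (h a).toENNReal ∂μ : ENNReal) : EReal) - ((∫⁻ a, (-h a).toENNReal ∂μ : ENNReal) : EReal)

/-! ### The static surplus-utility-tradeoff problem -/

/-- `(x, p)` is a single-period incentive compatible mechanism on the type space `[a, b]`:
`x` is an allocation probability and truthful reporting maximizes utility. -/
def StaticIC {a b : ℝ} (x p : Set.Icc a b → ℝ) : Prop :=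
  (∀ v, 0 ≤ x v ∧ x v ≤ 1) ∧
  ∀ v v' : Set.Icc a b, (v : ℝ) * x v' - p v' ≤ (v : ℝ) * x v - p v

/-- Feasibility for the *tight* problem: incentive compatible, with expected utility exactly `c`.
(Incentive compatibility makes `x` monotone and the utility Lipschitz, so the integral is that of a
bounded measurable function.) -/
def TightFeasible {a b : ℝ} (μ : Measure (Set.Icc a b)) (c : ℝ) (x p : Set.Icc a b → ℝ) : Prop :=
  StaticIC x p ∧ ∫ v, ((v : ℝ) * x v - p v) ∂μ = c

/-- The objective `E[v x(v) + g(v x(v) - p(v))]`. -/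
def tradeoffObj {a b : ℝ} (μ : Measure (Set.Icc a b)) (g : ℝ → EReal) (x p : Set.Icc a b → ℝ) :
    EReal :=
  extExp μ fun v => (((v : ℝ) * x v : ℝ) : EReal) + g ((v : ℝ) * x v - p v)

/-- The value of the tight surplus-utility-tradeoff problem. -/
def tradeoffValue {a b : ℝ} (μ : Measure (Set.Icc a b)) (g : ℝ → EReal) (c : ℝ) : EReal :=
  ⨆ (x : Set.Icc a b → ℝ) (p : Set.Icc a b → ℝ) (_ : TightFeasible μ c x p), tradeoffObj μ g x p

/-- `(x, p)` is an optimal solution of the tight surplus-utility-tradeoff problem. -/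
def IsTightOptimal {a b : ℝ} (μ : Measure (Set.Icc a b)) (g : ℝ → EReal) (c : ℝ)
    (x p : Set.Icc a b → ℝ) : Prop :=
  TightFeasible μ c x p ∧
  ∀ y q : Set.Icc a b → ℝ, TightFeasible μ c y q → tradeoffObj μ g y q ≤ tradeoffObj μ g x p

/-! ### Cumulative tradeoff functions

Days are numbered `0, …, k - 1`, so day `i` here is day `i + 1` in the usual numbering. -/

/-- The tradeoff function after the last day: `0` on `u ≥ 0` and `-∞` on `u < 0`. -/
def terminalTradeoff (u : ℝ) : EReal := if 0 ≤ u then 0 else ⊥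

/-- The tradeoff function used on day `i`, given the cumulative tradeoff function `G` of the next
day: on the first day it is `G u - u`, on the other days it is `G u`. -/
def dayTradeoff (i : ℕ) (G : ℝ → EReal) (u : ℝ) : EReal := if i = 0 then G u - (u : EReal) else G u

/-- The cumulative tradeoff function of day `i`, by backward recursion from the last day
`k - 1`; for `i ≥ k` it is the terminal function. -/
def cumTradeoff {k : ℕ} {lo hi : Fin k → ℝ} (μ : (i : Fin k) → Measure (Set.Icc (lo i) (hi i)))
    (i : ℕ) : ℝ → EReal :=
  if h : i < k then tradeoffValue (μ ⟨i, h⟩) (dayTradeoff i (cumTradeoff μ (i + 1)))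
  else terminalTradeoff
termination_by k - i

/-! ### Dynamic mechanisms -/

/-- Value profiles `(v_0, …, v_{k-1})` with `v_i ∈ [lo i, hi i]`. -/
abbrev Profile {k : ℕ} (lo hi : Fin k → ℝ) : Type := (i : Fin k) → Set.Icc (lo i) (hi i)

/-- `x` (a family of functions of the whole profile) is such that `x i` depends only on the history
of reports `v_{≤ i}`. -/
def HistoryAdapted {k : ℕ} {lo hi : Fin k → ℝ} (x : Fin k → Profile lo hi → ℝ) : Prop :=
  ∀ (i : Fin k) (v w : Profile lo hi), (∀ j, j ≤ i → v j = w j) → x i v = x i w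

/-- The profile that agrees with `v` up to and including day `i` and with `w` afterwards. -/
def splice {k : ℕ} {lo hi : Fin k → ℝ} (i : Fin k) (v w : Profile lo hi) : Profile lo hi :=
  fun j => if j ≤ i then v j else w j

/-- The stage utility `v_i x_i(v_{≤ i}) - p_i(v_{≤ i})` on day `i`. -/
def stageUtility {k : ℕ} {lo hi : Fin k → ℝ} (x p : Fin k → Profile lo hi → ℝ) (i : Fin k)
    (v : Profile lo hi) : ℝ :=
  (v i : ℝ) * x i v - p i v

/-- The expected utility from the days after day `i`, given the history `v_{≤ i}` of reports and
truthful reporting later on (values on different days are independent). -/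
def futureUtility {k : ℕ} {lo hi : Fin k → ℝ} (μ : (i : Fin k) → Measure (Set.Icc (lo i) (hi i)))
    (x p : Fin k → Profile lo hi → ℝ) (i : Fin k) (v : Profile lo hi) : ℝ :=
  ∫ w, ∑ j ∈ Finset.Ioi i, stageUtility x p j (splice i v w) ∂(Measure.pi μ)

/-- `(x, p)` is a dynamic mechanism: allocation probabilities and payments are measurable functions
of the history of reports, and expected payments are finite, initially and after each history. -/
structure IsMechanism {k : ℕ} {lo hi : Fin k → ℝ}
    (μ : (i : Fin k) → Measure (Set.Icc (lo i) (hi i))) (x p : Fin k → Profile lo hi → ℝ) :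
    Prop where
  adapted_alloc : HistoryAdapted x
  adapted_pay : HistoryAdapted p
  measurable_alloc : ∀ i, Measurable (x i)
  measurable_pay : ∀ i, Measurable (p i)
  alloc_mem : ∀ i v, 0 ≤ x i v ∧ x i v ≤ 1
  integrable_pay : ∀ i, Integrable (p i) (Measure.pi μ)
  integrable_future : ∀ (i j : Fin k) (v : Profile lo hi), i < j →
    Integrable (fun w => p j (splice i v w)) (Measure.pi μ)

/-- Periodic incentive compatibility: on each day `i` and after each history, the truthful report
of `v i` is at least as good as any report `v'`, given truthfulness on the following days. -/
def PeriodicIC {k : ℕ} {lo hi : Fin k → ℝ} (μ : (i : Fin k) → Measure (Set.Icc (lo i) (hi i)))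
    (x p : Fin k → Profile lo hi → ℝ) : Prop :=
  ∀ (i : Fin k) (v : Profile lo hi) (v' : Set.Icc (lo i) (hi i)),
    (v i : ℝ) * x i (Function.update v i v') - p i (Function.update v i v')
        + futureUtility μ x p i (Function.update v i v')
      ≤ (v i : ℝ) * x i v - p i v + futureUtility μ x p i v

/-- Stage-wise ex-post individual rationality. -/
def ExPostIR {k : ℕ} {lo hi : Fin k → ℝ} (x p : Fin k → Profile lo hi → ℝ) : Prop :=
  ∀ (i : Fin k) (v : Profile lo hi), 0 ≤ stageUtility x p i v

/-- Feasible mechanisms of the seller's problem. -/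
def Feasible {k : ℕ} {lo hi : Fin k → ℝ} (μ : (i : Fin k) → Measure (Set.Icc (lo i) (hi i)))
    (x p : Fin k → Profile lo hi → ℝ) : Prop :=
  IsMechanism μ x p ∧ PeriodicIC μ x p ∧ ExPostIR x p

/-- Expected revenue. -/
def revenue {k : ℕ} {lo hi : Fin k → ℝ} (μ : (i : Fin k) → Measure (Set.Icc (lo i) (hi i)))
    (p : Fin k → Profile lo hi → ℝ) : ℝ :=
  ∫ v, ∑ i, p i v ∂(Measure.pi μ)

/-- `(x, p)` is feasible and has maximal expected revenue among all feasible mechanisms. -/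
def IsOptimalMechanism {k : ℕ} {lo hi : Fin k → ℝ}
    (μ : (i : Fin k) → Measure (Set.Icc (lo i) (hi i))) (x p : Fin k → Profile lo hi → ℝ) : Prop :=
  Feasible μ x p ∧ ∀ y q : Fin k → Profile lo hi → ℝ, Feasible μ y q → revenue μ q ≤ revenue μ p

/-! ### The mechanism built in the forward pass -/

/-- A pre-processing output: for every day `i` and every real `c`, an optimal solution
`(X i c, P i c)` of the tight tradeoff problem that defines the cumulative tradeoff function of day
`i` at `c`, chosen measurably in `c` and the type. -/
structure IsPreprocessing {k : ℕ} {lo hi : Fin k → ℝ}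
    (μ : (i : Fin k) → Measure (Set.Icc (lo i) (hi i)))
    (X P : (i : Fin k) → ℝ → Set.Icc (lo i) (hi i) → ℝ) : Prop where
  optimal : ∀ (i : Fin k) (c : ℝ),
    IsTightOptimal (μ i) (dayTradeoff i (cumTradeoff μ (i + 1))) c (X i c) (P i c)
  measurable_alloc : ∀ i, Measurable fun z : ℝ × Set.Icc (lo i) (hi i) => X i z.1 z.2
  measurable_pay : ∀ i, Measurable fun z : ℝ × Set.Icc (lo i) (hi i) => P i z.1 z.2

/-- The scalar state at the beginning of day `i`: it starts at `c₀`, and day `i` updates `c` to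
`v_i X_i^c(v_i) - P_i^c(v_i)`. -/
def mechState {k : ℕ} {lo hi : Fin k → ℝ} (X P : (i : Fin k) → ℝ → Set.Icc (lo i) (hi i) → ℝ)
    (c₀ : ℝ) (v : Profile lo hi) : ℕ → ℝ
  | 0 => c₀
  | i + 1 =>
    if h : i < k then
      (v ⟨i, h⟩ : ℝ) * X ⟨i, h⟩ (mechState X P c₀ v i) (v ⟨i, h⟩)
        - P ⟨i, h⟩ (mechState X P c₀ v i) (v ⟨i, h⟩)
    else mechState X P c₀ v i

/-- Day `i` allocates with the probability given by the current state and the report. -/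
def forwardAlloc {k : ℕ} {lo hi : Fin k → ℝ} (X P : (i : Fin k) → ℝ → Set.Icc (lo i) (hi i) → ℝ)
    (c₀ : ℝ) (i : Fin k) (v : Profile lo hi) : ℝ :=
  X i (mechState X P c₀ v i) (v i)

/-- The full surplus is charged on each day but the last, the static payment on the last day. -/
def forwardPay {k : ℕ} {lo hi : Fin k → ℝ} (X P : (i : Fin k) → ℝ → Set.Icc (lo i) (hi i) → ℝ)
    (c₀ : ℝ) (i : Fin k) (v : Profile lo hi) : ℝ :=
  if (i : ℕ) + 1 < k then (v i : ℝ) * X i (mechState X P c₀ v i) (v i)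
  else P i (mechState X P c₀ v i) (v i)

end

/-!
The proof rests on the identity "revenue = welfare − expected utility of the buyer" and on the
expected future utility as the only relevant summary of a history.

*Upper bound.* Fix a feasible mechanism and a history. On the next day, the allocation as a function
of the report together with the total utility from that day on is a static incentive compatible
mechanism, and its expected utility is the utility promised by the history. By backward induction
the expected welfare after a history is at most the cumulative tradeoff function at the promised
utility (`Feasible.welfare_le`). Individual rationality is used in the form that the total utility
from day `n` on is at least the utility promised for day `n + 1`, and the cumulative tradeoff
functions of the later days are monotone (`monotone_cumTradeoff`). On the first day the promised
utility is subtracted, which turns welfare into revenue (`Feasible.revenue_le`).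

*Attainment.* In the forward mechanism the state is the promised utility, by tightness of the static
problems (`IsPreprocessing.tailExp_stageUtility_forward`), so a dynamic misreport is a misreport in
a static mechanism. Since the tradeoff functions are `-∞` exactly on the negative numbers, starting
from a nonnegative state all states stay nonnegative, for every history and not just almost surely,
because utilities are continuous and monotone and the support contains the lowest type
(`TightFeasible.utility_nonneg`). Hence the mechanism is feasible, all inequalities of the upper
bound are equalities, and its revenue is the maximum of the first cumulative tradeoff function
(`IsPreprocessing.revenue_forward`).

*Existence and measurability.* A static mechanism is encoded by its utility function `u`, a
continuous function on the type space; the allocation is a supporting slope of `u`, unique outside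
a countable set, which is null because the distribution has a density. Utility functions with a
bounded mean form a compact set (Arzelà–Ascoli), and the objective is upper semicontinuous on it
(`upperSemicontinuousOn_utilityObj`, by Fatou's lemma). This gives optimal solutions and upper
semicontinuity of the value (`upperSemicontinuous_levelSup`), which is what the next step of the
recursion needs. A measurable choice of solutions is made by maximizing a separating sequence of
continuous functions lexicographically over the compact set of solutions
(`exists_measurable_selection`).
-/

noncomputable section

open Filter Topology Set

/-! ### Expectations of extended-real functions -/

section ExtExp

variable {α : Type*} [MeasurableSpace α] {μ : Measure α}

theorem extExp_congr_ae {h h' : α → EReal} (hh : h =ᵐ[μ] h') : extExp μ h = extExp μ h' := by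
  unfold extExp
  rw [lintegral_congr_ae (g := fun a => (h' a).toENNReal) (hh.mono fun a ha => by simp only [ha]),
    lintegral_congr_ae (f := fun a => (-h a).toENNReal) (g := fun a => (-h' a).toENNReal)
      (hh.mono fun a ha => by simp only [ha])]

theorem extExp_mono_ae {h h' : α → EReal} (hh : ∀ᵐ a ∂μ, h a ≤ h' a) :
    extExp μ h ≤ extExp μ h' := by
  refine EReal.sub_le_sub ?_ ?_
  · exact_mod_cast lintegral_mono_ae (hh.mono fun a ha => EReal.toENNReal_le_toENNReal ha)
  · exact_mod_cast lintegral_mono_ae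
      (hh.mono fun a ha => EReal.toENNReal_le_toENNReal (EReal.neg_le_neg_iff.2 ha))

theorem extExp_coe {f : α → ℝ} (hf : Integrable f μ) :
    extExp μ (fun a => (f a : EReal)) = ((∫ a, f a ∂μ : ℝ) : EReal) := by
  have h1 : ∫⁻ a, ENNReal.ofReal (f a) ∂μ ≠ ⊤ := hf.lintegral_lt_top.ne
  have h2 : ∫⁻ a, ENNReal.ofReal (-f a) ∂μ ≠ ⊤ := hf.neg.lintegral_lt_top.ne
  rw [integral_eq_lintegral_pos_part_sub_lintegral_neg_part hf, EReal.coe_sub,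
    EReal.coe_ennreal_toReal h1, EReal.coe_ennreal_toReal h2]
  rfl

theorem extExp_const [IsProbabilityMeasure μ] (c : EReal) : extExp μ (fun _ => c) = c := by
  induction c with
  | bot => simp [extExp]
  | top => simp [extExp]
  | coe r => rw [extExp_coe (integrable_const r)]; simp

theorem extExp_le [IsProbabilityMeasure μ] {h : α → EReal} {c : EReal} (hh : ∀ a, h a ≤ c) :
    extExp μ h ≤ c :=
  (extExp_mono_ae (Eventually.of_forall hh)).trans_eq (extExp_const c)

/-- With the convention `∞ - ∞ = -∞`, a function that takes the value `-∞` with positive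
probability has expectation `-∞`. -/
theorem ae_ne_bot_of_extExp_ne_bot {h : α → EReal} (hm : AEMeasurable h μ)
    (hh : extExp μ h ≠ ⊥) : ∀ᵐ a ∂μ, h a ≠ ⊥ := by
  have h1 : ∫⁻ a, (-h a).toENNReal ∂μ ≠ ⊤ := by
    intro h1
    apply hh
    simp [extExp, h1]
  have h2 := ae_lt_top' (f := fun a => (-h a).toENNReal)
    (EReal.continuous_toENNReal.measurable.comp_aemeasurable hm.neg) h1
  filter_upwards [h2] with a ha hb
  simp [hb] at ha

/-- The expectation of a function bounded above by `M` is `M` minus the (nonnegative) expected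
shortfall. -/
theorem extExp_eq_sub_lintegral [IsProbabilityMeasure μ] {h : α → EReal} (hm : AEMeasurable h μ)
    {M : ℝ} (hM : 0 ≤ M) (hh : ∀ a, h a ≤ M) :
    extExp μ h = (M : EReal) - ((∫⁻ a, ((M : EReal) - h a).toENNReal ∂μ : ENNReal) : EReal) := by
  -- `h⁺ + (M - h) = M + h⁻`; integrating this identity avoids subtraction in `[0, ∞]`
  have key : ∀ a, (h a).toENNReal + ((M : EReal) - h a).toENNReal
      = ENNReal.ofReal M + (-h a).toENNReal := by
    intro a
    have ha := hh a
    induction hx : h a with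
    | bot => simp
    | top => simp [hx] at ha
    | coe r =>
      rw [hx] at ha
      have hr : r ≤ M := by exact_mod_cast ha
      rw [← EReal.coe_sub, ← EReal.coe_neg, EReal.real_coe_toENNReal, EReal.real_coe_toENNReal,
        EReal.real_coe_toENNReal]
      rcases le_total 0 r with h0 | h0
      · rw [← ENNReal.ofReal_add h0 (by linarith), ENNReal.ofReal_of_nonpos (p := -r) (by linarith)]
        simp
      · rw [← ENNReal.ofReal_add hM (by linarith), ENNReal.ofReal_of_nonpos h0]
        simp [sub_eq_add_neg]
  have hp : AEMeasurable (fun a => (h a).toENNReal) μ :=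
    EReal.continuous_toENNReal.measurable.comp_aemeasurable hm
  have hpos : ∫⁻ a, (h a).toENNReal ∂μ ≤ ENNReal.ofReal M := by
    calc ∫⁻ a, (h a).toENNReal ∂μ ≤ ∫⁻ _, ENNReal.ofReal M ∂μ :=
          lintegral_mono fun a => EReal.toENNReal_le_toENNReal (hh a)
      _ = ENNReal.ofReal M := by simp
  have hsum : ∫⁻ a, (h a).toENNReal ∂μ + ∫⁻ a, ((M : EReal) - h a).toENNReal ∂μ
      = ENNReal.ofReal M + ∫⁻ a, (-h a).toENNReal ∂μ := by
    rw [← lintegral_add_left' hp]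
    simp_rw [key]
    rw [lintegral_add_left' aemeasurable_const]
    simp
  have hMe : (M : EReal) = ((ENNReal.ofReal M : ENNReal) : EReal) := by
    rw [EReal.coe_ennreal_ofReal, max_eq_left hM]
  unfold extExp
  generalize ∫⁻ a, (h a).toENNReal ∂μ = p at *
  generalize ∫⁻ a, (-h a).toENNReal ∂μ = q at *
  generalize ∫⁻ a, ((M : EReal) - h a).toENNReal ∂μ = l at *
  have hpt : p ≠ ⊤ := (hpos.trans_lt ENNReal.ofReal_lt_top).ne
  lift p to NNReal using hpt
  by_cases hq : q = ⊤
  · subst hq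
    have : l = ⊤ := by
      by_contra hl
      lift l to NNReal using hl
      simp at hsum
    subst this
    simp
  · lift q to NNReal using hq
    have hl : l ≠ ⊤ := by
      rintro rfl
      simp at hsum
      exact ENNReal.add_ne_top.2 ⟨ENNReal.ofReal_ne_top, ENNReal.coe_ne_top⟩ hsum.symm
    lift l to NNReal using hl
    have h3 := congrArg ENNReal.toReal hsum
    rw [ENNReal.toReal_add (by simp) (by simp), ENNReal.toReal_add (by simp) (by simp),
      ENNReal.toReal_ofReal hM] at h3
    simp only [ENNReal.coe_toReal] at h3
    have e : ∀ r : NNReal, (((r : ENNReal)) : EReal) = ((r : ℝ) : EReal) := fun r => rfl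
    rw [e, e, e, ← EReal.coe_sub, ← EReal.coe_sub]
    congr 1
    linarith

end ExtExp

/-! ### Measurable selection of maximizers -/

section Selection

variable {α E : Type*} [TopologicalSpace E]

/-- The maximizers of `f` on each of the sets `S a`. -/
def argmaxOn (f : E → ℝ) (S : α → Set E) (a : α) : Set E :=
  {x ∈ S a | ∀ y ∈ S a, f y ≤ f x}

/-- Passing to the maximizers of a continuous function preserves measurability (in the sense of
hitting sets of closed sets) of a compact-valued correspondence. -/
theorem measurableSet_argmaxOn_inter [MeasurableSpace α] {f : E → ℝ} (hf : Continuous f)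
    {S : α → Set E}
    (hc : ∀ a, IsCompact (S a))
    (hm : ∀ F, IsClosed F → MeasurableSet {a | (S a ∩ F).Nonempty}) {F : Set E}
    (hF : IsClosed F) : MeasurableSet {a | (argmaxOn f S a ∩ F).Nonempty} := by
  have hlev : ∀ q : ℚ, IsClosed {x | (q : ℝ) ≤ f x} := fun q => isClosed_le continuous_const hf
  -- a maximizer over `S a ∩ F` maximizes over `S a` iff no rational level separates the two maxima
  have : {a | (argmaxOn f S a ∩ F).Nonempty} = {a | (S a ∩ F).Nonempty} ∩
      ⋂ q : ℚ, ({a | (S a ∩ {x | (q : ℝ) ≤ f x}).Nonempty}ᶜ ∪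
        {a | (S a ∩ (F ∩ {x | (q : ℝ) ≤ f x})).Nonempty}) := by
    ext a
    simp only [mem_inter_iff, mem_iInter, mem_union, mem_compl_iff, mem_ofPred_eq]
    constructor
    · rintro ⟨x, ⟨hx, hmax⟩, hxF⟩
      refine ⟨⟨x, hx, hxF⟩, fun q => ?_⟩
      by_cases h : (S a ∩ {x | (q : ℝ) ≤ f x}).Nonempty
      · obtain ⟨y, hy, hqy⟩ := h
        exact Or.inr ⟨x, hx, hxF, le_trans hqy (hmax y hy)⟩
      · exact Or.inl h
    · rintro ⟨hne, hq⟩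
      obtain ⟨x, ⟨hx, hxF⟩, hmax⟩ := ((hc a).inter_right hF).exists_isMaxOn hne hf.continuousOn
      refine ⟨x, ⟨hx, fun y hy => ?_⟩, hxF⟩
      by_contra hlt
      obtain ⟨q, hq1, hq2⟩ := exists_rat_btwn (not_le.1 hlt)
      rcases hq q with h | ⟨z, hz, hzF, hqz⟩
      · exact h ⟨y, hy, hq2.le⟩
      · have := isMaxOn_iff.1 hmax z ⟨hz, hzF⟩
        simp only [mem_ofPred_eq] at hqz
        linarith
  rw [this]
  exact (hm F hF).inter (MeasurableSet.iInter fun q =>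
    (hm _ (hlev q)).compl.union (hm _ (hF.inter (hlev q))))

theorem isCompact_argmaxOn {f : E → ℝ} (hf : Continuous f) {S : α → Set E}
    (hc : ∀ a, IsCompact (S a)) (a : α) : IsCompact (argmaxOn f S a) := by
  have : argmaxOn f S a = S a ∩ ⋂ y ∈ S a, {x | f y ≤ f x} := by
    ext x; simp [argmaxOn]
  rw [this]
  exact (hc a).inter_right
    (isClosed_biInter fun y _ => isClosed_le continuous_const hf)

/-- The sets obtained from `S a` by maximizing `f 0`, then `f 1` among the maximizers of `f 0`,
and so on. -/
def lexArgmax (f : ℕ → E → ℝ) (S : α → Set E) : ℕ → α → Set E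
  | 0 => S
  | n + 1 => argmaxOn (f n) (lexArgmax f S n)

/-- A measurable compact-valued correspondence has a measurable selection: among the points of
`S a` take the one that maximizes a separating sequence of continuous functions
lexicographically. -/
theorem exists_measurable_selection [MeasurableSpace α] [T2Space E] [MeasurableSpace E]
    [BorelSpace E]
    (f : ℕ → E → ℝ) (hf : ∀ n, Continuous (f n))
    (hsep : ∀ x y, (∀ n, f n x = f n y) → x = y) {S : α → Set E} (hc : ∀ a, IsCompact (S a))
    (hne : ∀ a, (S a).Nonempty)
    (hm : ∀ F, IsClosed F → MeasurableSet {a | (S a ∩ F).Nonempty}) :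
    ∃ s : α → E, Measurable s ∧ ∀ a, s a ∈ S a := by
  have hL : ∀ n, (∀ a, IsCompact (lexArgmax f S n a)) ∧ (∀ a, (lexArgmax f S n a).Nonempty) ∧
      ∀ F, IsClosed F → MeasurableSet {a | (lexArgmax f S n a ∩ F).Nonempty} := by
    intro n
    induction n with
    | zero => exact ⟨hc, hne, hm⟩
    | succ n ih =>
      obtain ⟨h1, h2, h3⟩ := ih
      refine ⟨isCompact_argmaxOn (hf n) h1, fun a => ?_,
        fun F hF => measurableSet_argmaxOn_inter (hf n) h1 h3 hF⟩
      obtain ⟨x, hx, hmax⟩ := (h1 a).exists_isMaxOn (h2 a) (hf n).continuousOn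
      exact ⟨x, hx, fun y hy => isMaxOn_iff.1 hmax y hy⟩
  have hmono : ∀ n a, lexArgmax f S (n + 1) a ⊆ lexArgmax f S n a := fun n a x hx => hx.1
  have hinter : ∀ F, IsClosed F → ∀ a, (∀ n, (lexArgmax f S n a ∩ F).Nonempty) →
      (⋂ n, (lexArgmax f S n a ∩ F)).Nonempty := fun F hF a h =>
    IsCompact.nonempty_iInter_of_sequence_nonempty_isCompact_isClosed _
      (fun n => inter_subset_inter_left _ (hmono n a)) h (((hL 0).1 a).inter_right hF)
      (fun n => ((hL n).1 a).isClosed.inter hF)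
  -- points in all the sets have the same values under every `f n`
  have huniq : ∀ a x y, (∀ n, x ∈ lexArgmax f S n a) → (∀ n, y ∈ lexArgmax f S n a) → x = y := by
    intro a x y hx hy
    exact hsep x y fun n => le_antisymm ((hy (n + 1)).2 x (hx n)) ((hx (n + 1)).2 y (hy n))
  have hex : ∀ a, ∃ x, ∀ n, x ∈ lexArgmax f S n a := by
    intro a
    obtain ⟨x, hx⟩ := hinter univ isClosed_univ a (fun n => by simpa using (hL n).2.1 a)
    exact ⟨x, fun n => (mem_iInter.1 hx n).1⟩
  choose s hs using hex
  refine ⟨s, measurable_of_isClosed fun F hF => ?_, fun a => hs a 0⟩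
  have : s ⁻¹' F = ⋂ n, {a | (lexArgmax f S n a ∩ F).Nonempty} := by
    ext a
    simp only [mem_preimage, mem_iInter, mem_ofPred_eq]
    constructor
    · exact fun h n => ⟨s a, hs a n, h⟩
    · intro h
      obtain ⟨x, hx⟩ := hinter F hF a h
      have hx' := mem_iInter.1 hx
      rw [huniq a (s a) x (hs a) fun n => (hx' n).1]
      exact (hx' 0).2
  rw [this]
  exact MeasurableSet.iInter fun n => (hL n).2.2 F hF

end Selection

section Parametric

variable {E : Type*} [TopologicalSpace E]

/-- The value at `c` of maximizing `J` over the points of `K` on which `φ` equals `c`. -/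
def levelSup (K : Set E) (φ : E → ℝ) (J : E → EReal) (c : ℝ) : EReal :=
  ⨆ u ∈ K ∩ φ ⁻¹' {c}, J u

/-- A continuous real function whose restriction to `K` is proper maps `K` to a closed set. -/
theorem isClosed_image_of_isCompact_inter {K : Set E} {φ : E → ℝ} (hφ : Continuous φ)
    (hK : ∀ R : ℝ, IsCompact (K ∩ φ ⁻¹' Icc (-R) R)) : IsClosed (φ '' K) := by
  refine isClosed_of_closure_subset fun c hc => ?_
  obtain ⟨y, hy, hyc⟩ := mem_closure_iff_seq_limit.1 hc
  have hcl : IsClosed (φ '' (K ∩ φ ⁻¹' Icc (-(|c| + 1)) (|c| + 1))) :=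
    ((hK _).image hφ).isClosed
  have hmem : c ∈ φ '' (K ∩ φ ⁻¹' Icc (-(|c| + 1)) (|c| + 1)) := by
    refine hcl.mem_of_tendsto hyc ?_
    have : Icc (-(|c| + 1)) (|c| + 1) ∈ 𝓝 c :=
      Icc_mem_nhds (by linarith [neg_abs_le c]) (by linarith [le_abs_self c])
    filter_upwards [hyc this] with n hn
    obtain ⟨u, hu, hun⟩ := hy n
    exact ⟨u, ⟨hu, by simpa [hun] using hn⟩, hun⟩
  exact image_mono inter_subset_left hmem

variable {K : Set E} {φ : E → ℝ} {J : E → EReal}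

theorem exists_isMax_level (hφ : Continuous φ)
    (hK : ∀ R : ℝ, IsCompact (K ∩ φ ⁻¹' Icc (-R) R)) (hJ : UpperSemicontinuousOn J K) {c : ℝ}
    (hne : (K ∩ φ ⁻¹' {c}).Nonempty) :
    ∃ u ∈ K ∩ φ ⁻¹' {c}, J u = levelSup K φ J c := by
  have hcomp : IsCompact (K ∩ φ ⁻¹' {c}) := by
    have : K ∩ φ ⁻¹' {c} = (K ∩ φ ⁻¹' Icc (-|c|) |c|) ∩ φ ⁻¹' {c} := by
      ext u
      simp only [mem_inter_iff, mem_preimage, mem_singleton_iff]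
      constructor
      · rintro ⟨h1, h2⟩
        exact ⟨⟨h1, by rw [h2]; exact ⟨neg_abs_le c, le_abs_self c⟩⟩, h2⟩
      · exact fun h => ⟨h.1.1, h.2⟩
    rw [this]
    exact (hK _).inter_right (isClosed_singleton.preimage hφ)
  obtain ⟨u, hu, hmax⟩ := (hJ.mono inter_subset_left).exists_isMaxOn hne hcomp
  exact ⟨u, hu, le_antisymm (le_iSup₂_of_le u hu le_rfl) (iSup₂_le (isMaxOn_iff.1 hmax))⟩

/-- A maximum-theorem: the value of maximizing an upper semicontinuous function over the level
sets of a proper map is upper semicontinuous in the level. -/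
theorem upperSemicontinuous_levelSup (hφ : Continuous φ)
    (hK : ∀ R : ℝ, IsCompact (K ∩ φ ⁻¹' Icc (-R) R)) (hJ : UpperSemicontinuousOn J K) :
    UpperSemicontinuous (levelSup K φ J) := by
  rw [upperSemicontinuous_iff_isClosed_preimage]
  intro t
  -- for `t = ⊥` the superlevel set is everything, including the levels without points of `K`
  rcases eq_or_ne t ⊥ with rfl | ht
  · simp
  obtain ⟨C, hC, hCeq⟩ := upperSemicontinuousOn_iff_preimage_Ici.1 hJ t
  have : levelSup K φ J ⁻¹' Ici t = φ '' (K ∩ C) := by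
    ext c
    rw [← hCeq]
    constructor
    · intro hc
      have hne : (K ∩ φ ⁻¹' {c}).Nonempty := by
        by_contra h
        rw [not_nonempty_iff_eq_empty] at h
        simp [levelSup, h, ht] at hc
      obtain ⟨u, hu, huJ⟩ := exists_isMax_level hφ hK hJ hne
      exact ⟨u, ⟨hu.1, hc.trans_eq huJ.symm⟩, hu.2⟩
    · rintro ⟨u, ⟨hu, hut⟩, rfl⟩
      exact le_trans hut (le_iSup₂_of_le (f := fun u _ => J u) u ⟨hu, rfl⟩ le_rfl)
  rw [this]
  refine isClosed_image_of_isCompact_inter hφ fun R => ?_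
  have : K ∩ C ∩ φ ⁻¹' Icc (-R) R = (K ∩ φ ⁻¹' Icc (-R) R) ∩ C := by
    ext; simp only [mem_inter_iff]; tauto
  rw [this]
  exact (hK R).inter_right hC

/-- Maximizers on the level sets can be selected measurably in the level. -/
theorem exists_measurable_argmax_level [T2Space E] [MeasurableSpace E] [BorelSpace E]
    (f : ℕ → E → ℝ) (hf : ∀ n, Continuous (f n))
    (hsep : ∀ x y, (∀ n, f n x = f n y) → x = y) (hφ : Continuous φ)
    (hK : ∀ R : ℝ, IsCompact (K ∩ φ ⁻¹' Icc (-R) R)) (hJ : UpperSemicontinuousOn J K)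
    (hne : ∀ c, (K ∩ φ ⁻¹' {c}).Nonempty) :
    ∃ s : ℝ → E, Measurable s ∧ ∀ c, s c ∈ K ∩ φ ⁻¹' {c} ∧ J (s c) = levelSup K φ J c := by
  have hS : ∀ F, IsClosed F → ∀ R : ℝ, IsCompact ((K ∩ F) ∩ φ ⁻¹' Icc (-R) R) := fun F hF R => by
    have : K ∩ F ∩ φ ⁻¹' Icc (-R) R = (K ∩ φ ⁻¹' Icc (-R) R) ∩ F := by
      ext; simp only [mem_inter_iff]; tauto
    rw [this]
    exact (hK R).inter_right hF
  have hle : ∀ c, ∀ u ∈ K ∩ φ ⁻¹' {c}, J u ≤ levelSup K φ J c := fun c u hu =>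
    le_iSup₂_of_le (f := fun u _ => J u) u hu le_rfl
  refine exists_measurable_selection (S := fun c => {u ∈ K ∩ φ ⁻¹' {c} | J u = levelSup K φ J c})
    f hf hsep (fun c => ?_) (fun c => ?_) fun F hF => ?_
  · obtain ⟨C, hC, hCeq⟩ := upperSemicontinuousOn_iff_preimage_Ici.1 hJ (levelSup K φ J c)
    have : {u ∈ K ∩ φ ⁻¹' {c} | J u = levelSup K φ J c} =
        (K ∩ φ ⁻¹' Icc (-|c|) |c|) ∩ (φ ⁻¹' {c} ∩ C) := by
      ext u
      constructor
      · rintro ⟨⟨h1, h2⟩, h3⟩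
        have h4 : u ∈ K ∩ C := hCeq ▸ ⟨h1, h3.ge⟩
        refine ⟨⟨h1, ?_⟩, h2, h4.2⟩
        rw [mem_preimage, mem_singleton_iff.1 h2]
        exact ⟨neg_abs_le c, le_abs_self c⟩
      · rintro ⟨⟨h1, -⟩, h2, h3⟩
        have h4 : u ∈ K ∩ J ⁻¹' Ici (levelSup K φ J c) := by rw [hCeq]; exact ⟨h1, h3⟩
        exact ⟨⟨h1, h2⟩, le_antisymm (hle c u ⟨h1, h2⟩) h4.2⟩
    rw [this]
    exact (hK _).inter_right ((isClosed_singleton.preimage hφ).inter hC)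
  · obtain ⟨u, hu, h⟩ := exists_isMax_level hφ hK hJ (hne c)
    exact ⟨u, hu, h⟩
  · have hJF : UpperSemicontinuousOn J (K ∩ F) := hJ.mono inter_subset_left
    -- a maximizer lies in `F` iff `F` meets the level and restricting to `F` loses no value
    have : {c | ({u ∈ K ∩ φ ⁻¹' {c} | J u = levelSup K φ J c} ∩ F).Nonempty} =
        (φ '' (K ∩ F)) ∩ {c | levelSup K φ J c ≤ levelSup (K ∩ F) φ J c} := by
      ext c
      constructor
      · rintro ⟨u, ⟨⟨h1, h2⟩, h3⟩, h4⟩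
        refine ⟨⟨u, ⟨h1, h4⟩, h2⟩, ?_⟩
        rw [mem_ofPred_eq, ← h3]
        exact le_iSup₂_of_le (f := fun u _ => J u) u ⟨⟨h1, h4⟩, h2⟩ le_rfl
      · rintro ⟨⟨w, hw, hwc⟩, hc⟩
        obtain ⟨u, hu, h⟩ := exists_isMax_level (c := c) hφ (hS F hF) hJF ⟨w, hw, hwc⟩
        exact ⟨u, ⟨⟨hu.1.1, hu.2⟩, le_antisymm (hle c u ⟨hu.1.1, hu.2⟩) (h.symm ▸ hc)⟩, hu.1.2⟩
    rw [this]
    exact (isClosed_image_of_isCompact_inter hφ (hS F hF)).measurableSet.inter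
      (measurableSet_le (upperSemicontinuous_levelSup hφ hK hJ).measurable
        (upperSemicontinuous_levelSup hφ (hS F hF) hJF).measurable)

end Parametric

/-! ### Utility functions of static incentive compatible mechanisms -/

section Static

variable {a b : ℝ}

/-- The slopes in `[0, 1]` of the affine functions that support `u` from below at `v`: the
allocation probabilities at `v` that are compatible with the utility function `u`. -/
def subgrad (u : C(Icc a b, ℝ)) (v : Icc a b) : Set ℝ :=
  {s ∈ Icc (0 : ℝ) 1 | ∀ v' : Icc a b, u v + s * ((v' : ℝ) - v) ≤ u v'}

/-- The utility functions of single-period incentive compatible mechanisms. -/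
def utilities (a b : ℝ) : Set C(Icc a b, ℝ) := {u | ∀ v, (subgrad u v).Nonempty}

/-- The largest allocation probability at `v` compatible with the utility function `u`. -/
def maxAlloc (u : C(Icc a b, ℝ)) (v : Icc a b) : ℝ := sSup (subgrad u v)

theorem isClosed_subgrad_graph :
    IsClosed {q : (C(Icc a b, ℝ) × Icc a b) × Icc (0 : ℝ) 1 |
      (q.2 : ℝ) ∈ subgrad q.1.1 q.1.2} := by
  have : {q : (C(Icc a b, ℝ) × Icc a b) × Icc (0 : ℝ) 1 | (q.2 : ℝ) ∈ subgrad q.1.1 q.1.2} =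
      ⋂ v' : Icc a b, {q | q.1.1 q.1.2 + q.2 * ((v' : ℝ) - q.1.2) ≤ q.1.1 v'} := by
    ext q
    simp [subgrad, q.2.2.1, q.2.2.2]
  rw [this]
  exact isClosed_iInter fun v' => isClosed_le (by fun_prop) (by fun_prop)

theorem isCompact_subgrad (u : C(Icc a b, ℝ)) (v : Icc a b) : IsCompact (subgrad u v) := by
  have : subgrad u v = Icc 0 1 ∩ ⋂ v' : Icc a b, {s | u v + s * ((v' : ℝ) - v) ≤ u v'} := by
    ext s; simp [subgrad]
  rw [this]
  exact isCompact_Icc.inter_right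
    (isClosed_iInter fun v' => isClosed_le (by fun_prop) (by fun_prop))

theorem maxAlloc_mem {u : C(Icc a b, ℝ)} (hu : u ∈ utilities a b) (v : Icc a b) :
    maxAlloc u v ∈ subgrad u v :=
  (isCompact_subgrad u v).sSup_mem (hu v)

theorem maxAlloc_mem_Icc (u : C(Icc a b, ℝ)) (v : Icc a b) : maxAlloc u v ∈ Icc (0 : ℝ) 1 :=
  ⟨Real.sSup_nonneg fun _ hs => hs.1.1, Real.sSup_le (fun _ hs => hs.1.2) zero_le_one⟩

/-- The superlevel sets of `maxAlloc` are projections of closed sets along `[0, 1]`. -/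
theorem upperSemicontinuous_maxAlloc :
    UpperSemicontinuous fun q : C(Icc a b, ℝ) × Icc a b => maxAlloc q.1 q.2 := by
  rw [upperSemicontinuous_iff_isClosed_preimage]
  intro t
  rcases le_or_gt t 0 with ht | ht
  · convert isClosed_univ
    ext q
    simpa using ht.trans (maxAlloc_mem_Icc q.1 q.2).1
  have : (fun q : C(Icc a b, ℝ) × Icc a b => maxAlloc q.1 q.2) ⁻¹' Ici t =
      Prod.fst '' ({q : (C(Icc a b, ℝ) × Icc a b) × Icc (0 : ℝ) 1 |
        (q.2 : ℝ) ∈ subgrad q.1.1 q.1.2} ∩ {q | t ≤ (q.2 : ℝ)}) := by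
    ext q
    constructor
    · intro hq
      have hne : (subgrad q.1 q.2).Nonempty := by
        by_contra h
        rw [not_nonempty_iff_eq_empty] at h
        simp only [mem_preimage, maxAlloc, h, Real.sSup_empty, mem_Ici] at hq
        linarith
      exact ⟨(q, ⟨maxAlloc q.1 q.2, maxAlloc_mem_Icc _ _⟩),
        ⟨(isCompact_subgrad q.1 q.2).sSup_mem hne, hq⟩, rfl⟩
    · rintro ⟨⟨q', s⟩, ⟨h1, h2⟩, rfl⟩
      exact le_trans h2 (le_csSup (isCompact_subgrad q'.1 q'.2).bddAbove h1)
  rw [this]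
  exact isClosedMap_fst_of_compactSpace _
    (isClosed_subgrad_graph.inter (isClosed_le (by fun_prop) (by fun_prop)))

theorem measurable_maxAlloc (u : C(Icc a b, ℝ)) : Measurable (maxAlloc u) := by
  have : UpperSemicontinuous (maxAlloc u) := by
    rw [upperSemicontinuous_iff_isClosed_preimage]
    intro t
    exact (upperSemicontinuous_iff_isClosed_preimage.1 upperSemicontinuous_maxAlloc t).preimage
      (by fun_prop : Continuous fun v : Icc a b => (u, v))
  exact this.measurable

theorem isClosed_utilities : IsClosed (utilities a b) := by
  have : utilities a b = ⋂ v : Icc a b, (fun u => (u, v)) ⁻¹' (Prod.fst ''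
      {q : (C(Icc a b, ℝ) × Icc a b) × Icc (0 : ℝ) 1 | (q.2 : ℝ) ∈ subgrad q.1.1 q.1.2}) := by
    ext u
    simp only [mem_iInter]
    constructor
    · intro hu v
      obtain ⟨s, hs⟩ := hu v
      exact ⟨((u, v), ⟨s, hs.1⟩), hs, rfl⟩
    · intro h v
      obtain ⟨⟨q, s⟩, hq, hqv⟩ := h v
      simp only at hqv
      subst hqv
      exact ⟨s, hq⟩
  rw [this]
  exact isClosed_iInter fun v => (isClosedMap_fst_of_compactSpace _ isClosed_subgrad_graph).preimage
    (by fun_prop)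

theorem utilities_monotone {u : C(Icc a b, ℝ)} (hu : u ∈ utilities a b) : Monotone u := by
  intro v v' h
  obtain ⟨s, hs, hs'⟩ := hu v
  have h1 := hs' v'
  have h2 : (0 : ℝ) ≤ (v' : ℝ) - v := sub_nonneg.2 h
  nlinarith [hs.1]

theorem utilities_sub_le {u : C(Icc a b, ℝ)} (hu : u ∈ utilities a b) (v v' : Icc a b) :
    u v' - u v ≤ |(v' : ℝ) - v| := by
  obtain ⟨s, hs, hs'⟩ := hu v'
  have h1 := hs' v
  have h2 : s * ((v' : ℝ) - v) ≤ |s * ((v' : ℝ) - v)| := le_abs_self _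
  rw [abs_mul, abs_of_nonneg hs.1] at h2
  nlinarith [hs.2, abs_nonneg ((v' : ℝ) - v)]

theorem utilities_dist_le {u : C(Icc a b, ℝ)} (hu : u ∈ utilities a b) (v v' : Icc a b) :
    |u v' - u v| ≤ |(v' : ℝ) - v| := by
  rw [abs_le]
  have := utilities_sub_le hu v' v
  rw [abs_sub_comm] at this
  exact ⟨by linarith, utilities_sub_le hu v v'⟩

theorem staticIC_of_mem_subgrad {u : C(Icc a b, ℝ)} {x : Icc a b → ℝ}
    (hx : ∀ v, x v ∈ subgrad u v) : StaticIC x fun v => (v : ℝ) * x v - u v := by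
  refine ⟨fun v => (hx v).1, fun v v' => ?_⟩
  have := (hx v').2 v
  linarith

theorem StaticIC.exists_utility {x p : Icc a b → ℝ} (h : StaticIC x p) :
    ∃ u : C(Icc a b, ℝ), (∀ v, u v = (v : ℝ) * x v - p v) ∧ ∀ v, x v ∈ subgrad u v := by
  have hsub : ∀ v v' : Icc a b, ((v : ℝ) * x v - p v) + x v * ((v' : ℝ) - v)
      ≤ (v' : ℝ) * x v' - p v' := fun v v' => by linarith [h.2 v' v]
  have hlip : LipschitzWith 1 fun v : Icc a b => (v : ℝ) * x v - p v := by
    refine LipschitzWith.of_dist_le_mul fun v v' => ?_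
    rw [Real.dist_eq, Subtype.dist_eq, Real.dist_eq, NNReal.coe_one, one_mul, abs_le]
    have h1 := hsub v v'
    have h2 := hsub v' v
    rcases abs_cases ((v : ℝ) - v') with ⟨h3, h4⟩ | ⟨h3, h4⟩ <;> rw [h3] <;>
      constructor <;> nlinarith [h.1 v, h.1 v']
  exact ⟨⟨_, hlip.continuous⟩, fun v => rfl, fun v => ⟨h.1 v, hsub v⟩⟩

theorem monotone_of_mem_subgrad {u : C(Icc a b, ℝ)} {x : Icc a b → ℝ}
    (hx : ∀ v, x v ∈ subgrad u v) : Monotone x := by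
  intro v v' hv
  rcases eq_or_lt_of_le hv with rfl | hlt
  · exact le_rfl
  have h1 := (hx v).2 v'
  have h2 := (hx v').2 v
  have h3 : (0 : ℝ) < (v' : ℝ) - v := sub_pos.2 hlt
  nlinarith

/-- At an interior point of continuity of one selection of slopes, the slope is unique. -/
theorem subgrad_eq_of_continuousAt {u : C(Icc a b, ℝ)} {x : Icc a b → ℝ}
    (hx : ∀ v, x v ∈ subgrad u v) {v : Icc a b} (hc : ContinuousAt x v) (hva : a < v)
    (hvb : (v : ℝ) < b) {s : ℝ} (hs : s ∈ subgrad u v) : s = x v := by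
  have key : ∀ v' : Icc a b, v < v' → s ≤ x v' := by
    intro v' hlt
    have h1 := hs.2 v'
    have h2 := (hx v').2 v
    have h3 : (0 : ℝ) < (v' : ℝ) - v := sub_pos.2 hlt
    nlinarith
  have key' : ∀ v' : Icc a b, v' < v → x v' ≤ s := by
    intro v' hlt
    have h1 := hs.2 v'
    have h2 := (hx v').2 v
    have h3 : (0 : ℝ) < (v : ℝ) - v' := sub_pos.2 hlt
    nlinarith
  set z : ℝ → Icc a b := projIcc a b (by linarith) with hz
  have hzc : Continuous z := continuous_projIcc
  have hzv : z v = v := projIcc_val _ v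
  have hcz : Tendsto (fun t => x (z t)) (𝓝 (v : ℝ)) (𝓝 (x v)) :=
    hc.tendsto.comp (by simpa only [hzv] using hzc.tendsto (v : ℝ))
  apply le_antisymm
  · refine ge_of_tendsto (hcz.mono_left (nhdsWithin_le_nhds (s := Ioi (v : ℝ)))) ?_
    filter_upwards [Ioo_mem_nhdsGT hvb] with t ht
    refine key _ ?_
    rw [hz, projIcc_of_mem _ ⟨(hva.trans ht.1).le, ht.2.le⟩]
    exact ht.1
  · refine le_of_tendsto (hcz.mono_left (nhdsWithin_le_nhds (s := Iio (v : ℝ)))) ?_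
    filter_upwards [Ioo_mem_nhdsLT hva] with t ht
    refine key' _ ?_
    rw [hz, projIcc_of_mem _ ⟨ht.1.le, (ht.2.trans hvb).le⟩]
    exact ht.2

variable {μ : Measure (Icc a b)}

/-- An allocation is monotone, so it has countably many discontinuities, and these are a null set
of an atomless distribution. -/
theorem ae_subgrad_eq [NullSingletonClass μ] {u : C(Icc a b, ℝ)} {x : Icc a b → ℝ}
    (hx : ∀ v, x v ∈ subgrad u v) : ∀ᵐ v ∂μ, ∀ s ∈ subgrad u v, s = x v := by
  have h1 := (monotone_of_mem_subgrad hx).countable_not_continuousAt.ae_notMem μ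
  have h2 : {v : Icc a b | (v : ℝ) = a}.Countable :=
    Set.Subsingleton.countable fun v hv w hw => Subtype.ext (Eq.trans hv (Eq.symm hw))
  have h3 : {v : Icc a b | (v : ℝ) = b}.Countable :=
    Set.Subsingleton.countable fun v hv w hw => Subtype.ext (Eq.trans hv (Eq.symm hw))
  filter_upwards [h1, h2.ae_notMem μ, h3.ae_notMem μ] with v hv1 hv2 hv3 s hs
  exact subgrad_eq_of_continuousAt hx (not_not.1 hv1) (lt_of_le_of_ne v.2.1 (Ne.symm hv2))
    (lt_of_le_of_ne v.2.2 hv3) hs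

/-- Where the slope of `u` is unique, the allocation is continuous in the utility function. -/
theorem tendsto_maxAlloc {u : C(Icc a b, ℝ)} {v : Icc a b}
    (hv : ∀ s ∈ subgrad u v, s = maxAlloc u v) :
    Tendsto (fun w => maxAlloc w v) (𝓝[utilities a b] u) (𝓝 (maxAlloc u v)) := by
  refine isCompact_Icc.tendsto_nhds_of_unique_mapClusterPt (s := Icc (0 : ℝ) 1)
    (Eventually.of_forall fun w => maxAlloc_mem_Icc w v) fun s hs hcl => hv s ⟨hs, fun v' => ?_⟩
  obtain ⟨F, hFle, hF⟩ := mapClusterPt_iff_ultrafilter.1 hcl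
  have hFu : Tendsto (fun w : C(Icc a b, ℝ) => w) F (𝓝 u) := hFle.trans nhdsWithin_le_nhds
  have e1 : ∀ t : Icc a b, Tendsto (fun w : C(Icc a b, ℝ) => w t) F (𝓝 (u t)) := fun t =>
    ((by fun_prop : Continuous fun w : C(Icc a b, ℝ) => w t).tendsto u).comp hFu
  refine le_of_tendsto_of_tendsto ((e1 v).add (hF.mul_const ((v' : ℝ) - v))) (e1 v') ?_
  filter_upwards [hFle self_mem_nhdsWithin] with w hw
  exact (maxAlloc_mem hw v).2 v'

theorem continuous_integral_utility [IsProbabilityMeasure μ] :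
    Continuous fun u : C(Icc a b, ℝ) => ∫ v, u v ∂μ := by
  have hint : ∀ u : C(Icc a b, ℝ), Integrable u μ := fun u =>
    u.continuous.integrable_of_hasCompactSupport (HasCompactSupport.of_compactSpace _)
  refine (LipschitzWith.of_dist_le_mul (K := 1) fun u w => ?_).continuous
  rw [dist_eq_norm, dist_eq_norm, ← integral_sub (hint u) (hint w), NNReal.coe_one, one_mul]
  refine (norm_integral_le_of_norm_le_const (Eventually.of_forall fun v => ?_)).trans_eq
    (by rw [probReal_univ, mul_one])
  exact (u - w).norm_coe_le_norm v

theorem abs_utility_sub_integral_le [IsProbabilityMeasure μ] {u : C(Icc a b, ℝ)}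
    (hu : u ∈ utilities a b) (v : Icc a b) : |u v - ∫ w, u w ∂μ| ≤ b - a := by
  have hint : Integrable u μ :=
    u.continuous.integrable_of_hasCompactSupport (HasCompactSupport.of_compactSpace _)
  have : u v - ∫ w, u w ∂μ = ∫ w, (u v - u w) ∂μ := by
    rw [integral_sub (integrable_const _) hint]; simp
  rw [this, ← Real.norm_eq_abs]
  refine (norm_integral_le_of_norm_le_const (Eventually.of_forall fun w => ?_)).trans_eq
    (by rw [probReal_univ, mul_one])
  refine (utilities_dist_le hu w v).trans ?_
  rw [abs_le]
  constructor <;> linarith [v.2.1, v.2.2, w.2.1, w.2.2]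

theorem isCompact_utilities_inter [IsProbabilityMeasure μ] (R : ℝ) :
    IsCompact (utilities a b ∩ (fun u : C(Icc a b, ℝ) => ∫ v, u v ∂μ) ⁻¹' Icc (-R) R) := by
  set S := utilities a b ∩ (fun u : C(Icc a b, ℝ) => ∫ v, u v ∂μ) ⁻¹' Icc (-R) R with hS
  have hScl : IsClosed S :=
    isClosed_utilities.inter (isClosed_Icc.preimage continuous_integral_utility)
  have hlip : ∀ u ∈ S, LipschitzWith 1 u := fun u hu =>
    LipschitzWith.of_dist_le_mul fun v v' => by
      rw [NNReal.coe_one, one_mul]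
      exact utilities_dist_le hu.1 v' v
  have hbd : ∀ u ∈ S, ∀ v, u v ∈ Icc (-(R + (b - a))) (R + (b - a)) := fun u hu v => by
    have h1 := abs_le.1 (abs_utility_sub_integral_le (μ := μ) hu.1 v)
    have h2 : (∫ w, u w ∂μ) ∈ Icc (-R) R := hu.2
    exact ⟨by linarith [h2.1, h1.1], by linarith [h2.2, h1.2]⟩
  let A : Set (BoundedContinuousFunction (Icc a b) ℝ) :=
    (ContinuousMap.equivBoundedOfCompact (Icc a b) ℝ) '' S
  have hA : IsCompact A := by
    refine BoundedContinuousFunction.arzela_ascoli₂ (Icc (-(R + (b - a))) (R + (b - a)))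
      isCompact_Icc A ?_ ?_ ?_
    · exact ((ContinuousMap.isometryEquivBoundedOfCompact (Icc a b) ℝ).toHomeomorph.isClosed_image
        (s := S)).2 hScl
    · rintro f v ⟨u, hu, rfl⟩
      exact hbd u hu v
    · refine (LipschitzWith.uniformEquicontinuous _ 1 ?_).equicontinuous
      rintro ⟨f, u, hu, rfl⟩
      exact hlip u hu
  have := hA.image (ContinuousMap.isometryEquivBoundedOfCompact (Icc a b) ℝ).symm.continuous
  have hSA : S = (ContinuousMap.isometryEquivBoundedOfCompact (Icc a b) ℝ).symm '' A := ?_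
  · rwa [hSA]
  refine Set.ext fun u => ?_
  constructor
  · exact fun hu => ⟨_, ⟨u, hu, rfl⟩, rfl⟩
  · rintro ⟨_, ⟨w, hw, rfl⟩, rfl⟩
    exact hw

end Static

/-! ### Existence and measurability of optimal static mechanisms -/

section Objective

variable {a b : ℝ} {μ : Measure (Icc a b)} {g : ℝ → EReal}

/-- The objective of the tradeoff problem as a functional of the utility function. -/
def utilityObj (μ : Measure (Icc a b)) (g : ℝ → EReal) (u : C(Icc a b, ℝ)) : EReal :=
  extExp μ fun v => (((v : ℝ) * maxAlloc u v : ℝ) : EReal) + g (u v)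

/-- The objective depends on a mechanism only through its utility function: any two compatible
allocations agree almost surely. -/
theorem tradeoffObj_eq_utilityObj [NullSingletonClass μ] {u : C(Icc a b, ℝ)}
    {x p : Icc a b → ℝ} (hup : ∀ v, u v = (v : ℝ) * x v - p v) (hx : ∀ v, x v ∈ subgrad u v) :
    tradeoffObj μ g x p = utilityObj μ g u := by
  refine extExp_congr_ae ?_
  filter_upwards [ae_subgrad_eq (μ := μ) hx] with v hv
  rw [hv _ (maxAlloc_mem (fun w => ⟨x w, hx w⟩) v), ← hup v]

theorem continuous_coe_sub (M : ℝ) : Continuous fun e : EReal => (M : EReal) - e := by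
  simp_rw [sub_eq_add_neg]
  refine continuous_iff_continuousAt.2 fun e => ?_
  exact (EReal.continuousAt_add (p := ((M : EReal), -e)) (Or.inl (EReal.coe_ne_top M))
    (Or.inl (EReal.coe_ne_bot M))).comp
    (f := fun e : EReal => ((M : EReal), -e)) (by fun_prop)

theorem antitone_coe_sub (M : ℝ) : Antitone fun e : EReal => (M : EReal) - e :=
  fun _ _ h => EReal.sub_le_sub le_rfl h

theorem upperSemicontinuous_coe_add {E : Type*} [TopologicalSpace E] {f : E → ℝ}
    (hf : Continuous f) {h : E → EReal} (hh : UpperSemicontinuous h) :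
    UpperSemicontinuous fun x => (f x : EReal) + h x := by
  refine UpperSemicontinuous.add' ?_ hh fun x => EReal.continuousAt_add
    (Or.inl (EReal.coe_ne_top _)) (Or.inl (EReal.coe_ne_bot _))
  exact (continuous_coe_real_ereal.comp hf).upperSemicontinuous

theorem value_mul_alloc_le (v : Icc a b) {s : ℝ} (hs : s ∈ Icc (0 : ℝ) 1) :
    |(v : ℝ) * s| ≤ max |a| |b| := by
  rw [abs_mul, abs_of_nonneg hs.1]
  have h1 : |(v : ℝ)| ≤ max |a| |b| := abs_le_max_abs_abs v.2.1 v.2.2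
  nlinarith [hs.2, abs_nonneg (v : ℝ)]

theorem measurable_objective (hg : UpperSemicontinuous g) (u : C(Icc a b, ℝ)) :
    Measurable fun v : Icc a b => (((v : ℝ) * maxAlloc u v : ℝ) : EReal) + g (u v) :=
  ((measurable_subtype_coe.mul (measurable_maxAlloc u)).coe_real_ereal).add
    (hg.measurable.comp u.continuous.measurable)

/-- The objective is upper semicontinuous in the utility function, by Fatou's lemma and the
almost sure continuity of the allocation. -/
theorem upperSemicontinuousOn_utilityObj [IsProbabilityMeasure μ] [NullSingletonClass μ]
    (hg : UpperSemicontinuous g) {M : ℝ} (hM : ∀ t, g t ≤ M) :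
    UpperSemicontinuousOn (utilityObj μ g) (utilities a b) := by
  set N : ℝ := max |a| |b| + max M 0 with hN
  have hN0 : 0 ≤ N := add_nonneg (le_max_of_le_left (abs_nonneg a)) (le_max_right _ _)
  have hle : ∀ (u : C(Icc a b, ℝ)) (v : Icc a b),
      (((v : ℝ) * maxAlloc u v : ℝ) : EReal) + g (u v) ≤ (N : EReal) := fun u v => by
    rw [hN, EReal.coe_add]
    refine add_le_add ?_ ((hM _).trans ?_)
    · exact_mod_cast (le_abs_self _).trans (value_mul_alloc_le v (maxAlloc_mem_Icc u v))
    · exact_mod_cast le_max_left M 0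
  -- the expected shortfall from the bound `N`, to which Fatou's lemma applies
  let L : C(Icc a b, ℝ) → ENNReal := fun u =>
    ∫⁻ v, ((N : EReal) - ((((v : ℝ) * maxAlloc u v : ℝ) : EReal) + g (u v))).toENNReal ∂μ
  have hJ : utilityObj μ g =
      (fun e : EReal => (N : EReal) - e) ∘ fun u => ((L u : ENNReal) : EReal) :=
    funext fun u => extExp_eq_sub_lintegral (measurable_objective hg u).aemeasurable hN0 (hle u)
  have hL : LowerSemicontinuousOn L (utilities a b) := by
    rw [lowerSemicontinuousOn_iff_le_liminf]
    intro u hu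
    refine le_trans (lintegral_mono_ae ?_) (lintegral_liminf_le fun w =>
      EReal.continuous_toENNReal.measurable.comp
        ((continuous_coe_sub N).measurable.comp (measurable_objective hg w)))
    filter_upwards [ae_subgrad_eq (μ := μ) (maxAlloc_mem hu)] with v hv
    have husc : UpperSemicontinuous fun q : ℝ × ℝ => (((v : ℝ) * q.1 : ℝ) : EReal) + g q.2 := by
      refine upperSemicontinuous_coe_add (by fun_prop) ?_
      rw [upperSemicontinuous_iff_isClosed_preimage] at hg ⊢
      exact fun y => (hg y).preimage continuous_snd
    have hlsc := (EReal.continuous_toENNReal.comp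
      (continuous_coe_sub N)).comp_upperSemicontinuous_antitone husc
      fun _ _ h => EReal.toENNReal_le_toENNReal (antitone_coe_sub N h)
    have htend : Tendsto (fun w : C(Icc a b, ℝ) => (maxAlloc w v, w v)) (𝓝[utilities a b] u)
        (𝓝 (maxAlloc u v, u v)) := by
      refine (tendsto_maxAlloc hv).prodMk_nhds ?_
      exact ((by fun_prop : Continuous fun w : C(Icc a b, ℝ) => w v).tendsto u).mono_left
        nhdsWithin_le_nhds
    refine le_of_forall_lt fun y hy => ?_
    obtain ⟨y', hy1, hy2⟩ := exists_between hy
    exact hy1.trans_le (le_liminf_of_le (by isBoundedDefault)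
      ((htend.eventually (hlsc (maxAlloc u v, u v) y' hy2)).mono fun w hw => hw.le))
  rw [hJ]
  refine ((continuous_coe_sub N).comp
    continuous_coe_ennreal_ereal).comp_lowerSemicontinuousOn_antitone hL ?_
  exact fun _ _ h => antitone_coe_sub N (EReal.coe_ennreal_le_coe_ennreal_iff.2 h)

theorem TightFeasible.exists_utility {c : ℝ} {x p : Icc a b → ℝ} (h : TightFeasible μ c x p) :
    ∃ u ∈ utilities a b ∩ (fun u : C(Icc a b, ℝ) => ∫ v, u v ∂μ) ⁻¹' {c},
      (∀ v, u v = (v : ℝ) * x v - p v) ∧ ∀ v, x v ∈ subgrad u v := by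
  obtain ⟨u, hu, hx⟩ := h.1.exists_utility
  refine ⟨u, ⟨fun v => ⟨x v, hx v⟩, ?_⟩, hu, hx⟩
  simp only [mem_preimage, mem_singleton_iff, hu, h.2]

theorem tightFeasible_of_mem {c : ℝ} {u : C(Icc a b, ℝ)}
    (hu : u ∈ utilities a b ∩ (fun u : C(Icc a b, ℝ) => ∫ v, u v ∂μ) ⁻¹' {c}) :
    TightFeasible μ c (maxAlloc u) fun v => (v : ℝ) * maxAlloc u v - u v := by
  refine ⟨staticIC_of_mem_subgrad (maxAlloc_mem hu.1), ?_⟩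
  simpa using hu.2

theorem tradeoffObj_maxAlloc {u : C(Icc a b, ℝ)} :
    tradeoffObj μ g (maxAlloc u) (fun v => (v : ℝ) * maxAlloc u v - u v) = utilityObj μ g u := by
  simp [tradeoffObj, utilityObj]

theorem tradeoffValue_eq_levelSup [NullSingletonClass μ] (c : ℝ) :
    tradeoffValue μ g c =
      levelSup (utilities a b) (fun u => ∫ v, u v ∂μ) (utilityObj μ g) c := by
  apply le_antisymm
  · refine iSup_le fun x => iSup_le fun p => iSup_le fun h => ?_
    obtain ⟨u, hu, hup, hx⟩ := h.exists_utility
    rw [tradeoffObj_eq_utilityObj hup hx]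
    exact le_iSup₂_of_le (f := fun u _ => utilityObj μ g u) u hu le_rfl
  · refine iSup₂_le fun u hu => ?_
    rw [← tradeoffObj_maxAlloc]
    exact le_iSup_of_le _ (le_iSup_of_le _ (le_iSup_of_le (tightFeasible_of_mem hu) le_rfl))

theorem tightFeasible_const [IsProbabilityMeasure μ] (c : ℝ) :
    TightFeasible μ c (fun _ => 0) (fun _ => -c) := by
  refine ⟨⟨fun _ => by simp, fun _ _ => by simp⟩, by simp⟩

theorem tradeoffObj_le_value {c : ℝ} {x p : Icc a b → ℝ} (h : TightFeasible μ c x p) :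
    tradeoffObj μ g x p ≤ tradeoffValue μ g c :=
  le_iSup_of_le x (le_iSup_of_le p (le_iSup_of_le h le_rfl))

theorem IsTightOptimal.obj_eq {c : ℝ} {x p : Icc a b → ℝ} (h : IsTightOptimal μ g c x p) :
    tradeoffObj μ g x p = tradeoffValue μ g c :=
  le_antisymm (tradeoffObj_le_value h.1)
    (iSup_le fun y => iSup_le fun q => iSup_le fun hyq => h.2 y q hyq)

theorem upperSemicontinuous_tradeoffValue [IsProbabilityMeasure μ] [NullSingletonClass μ]
    (hg : UpperSemicontinuous g) {M : ℝ} (hM : ∀ t, g t ≤ M) :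
    UpperSemicontinuous (tradeoffValue μ g) := by
  rw [funext (tradeoffValue_eq_levelSup (μ := μ) (g := g))]
  exact upperSemicontinuous_levelSup continuous_integral_utility isCompact_utilities_inter
    (upperSemicontinuousOn_utilityObj hg hM)

theorem exists_measurable_isTightOptimal [IsProbabilityMeasure μ] [NullSingletonClass μ]
    (hg : UpperSemicontinuous g) {M : ℝ} (hM : ∀ t, g t ≤ M) :
    ∃ X P : ℝ → Icc a b → ℝ, (∀ c, IsTightOptimal μ g c (X c) (P c)) ∧
      (Measurable fun z : ℝ × Icc a b => X z.1 z.2) ∧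
      Measurable fun z : ℝ × Icc a b => P z.1 z.2 := by
  let _ : MeasurableSpace C(Icc a b, ℝ) := borel _
  have : BorelSpace C(Icc a b, ℝ) := ⟨rfl⟩
  have hne : Nonempty (Icc a b) := by
    by_contra h
    rw [not_nonempty_iff] at h
    have := measure_univ (μ := μ)
    rw [univ_eq_empty_iff.2 h, measure_empty] at this
    exact zero_ne_one this
  obtain ⟨s, hs, hs'⟩ := exists_measurable_argmax_level (K := utilities a b)
    (J := utilityObj μ g) (fun n u => u (TopologicalSpace.denseSeq (Icc a b) n))
    (fun n => by fun_prop)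
    (fun u w h => ContinuousMap.coe_injective ((TopologicalSpace.denseRange_denseSeq _).equalizer
      u.continuous w.continuous (funext h)))
    (continuous_integral_utility (μ := μ)) isCompact_utilities_inter
    (upperSemicontinuousOn_utilityObj hg hM)
    (fun c => by
      obtain ⟨u, hu, -⟩ := (tightFeasible_const (μ := μ) c).exists_utility
      exact ⟨u, hu⟩)
  have hsv : Measurable fun z : ℝ × Icc a b => (s z.1, z.2) :=
    (hs.comp measurable_fst).prodMk measurable_snd
  have hX : Measurable fun z : ℝ × Icc a b => maxAlloc (s z.1) z.2 :=
    upperSemicontinuous_maxAlloc.measurable.comp hsv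
  have hU : Measurable fun z : ℝ × Icc a b => s z.1 z.2 :=
    (by fun_prop : Continuous fun q : C(Icc a b, ℝ) × Icc a b => q.1 q.2).measurable.comp hsv
  refine ⟨fun c => maxAlloc (s c), fun c v => (v : ℝ) * maxAlloc (s c) v - s c v,
    fun c => ⟨tightFeasible_of_mem (hs' c).1, fun y q hyq => ?_⟩, hX,
    ((measurable_subtype_coe.comp measurable_snd).mul hX).sub hU⟩
  rw [tradeoffObj_maxAlloc, (hs' c).2, ← tradeoffValue_eq_levelSup]
  exact tradeoffObj_le_value hyq

theorem tradeoffValue_le [IsProbabilityMeasure μ] {M : ℝ} (hM : ∀ t, g t ≤ M) (c : ℝ) :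
    tradeoffValue μ g c ≤ ((max |a| |b| + M : ℝ) : EReal) := by
  refine iSup_le fun x => iSup_le fun p => iSup_le fun h => extExp_le fun v => ?_
  rw [EReal.coe_add]
  refine add_le_add ?_ (hM _)
  exact_mod_cast (le_abs_self _).trans (value_mul_alloc_le v (h.1.1 v))

/-- Never allocating and paying out `c` is feasible and has the objective `g c`. -/
theorem le_tradeoffValue [IsProbabilityMeasure μ] (c : ℝ) : g c ≤ tradeoffValue μ g c := by
  refine le_trans (le_of_eq ?_) (tradeoffObj_le_value (tightFeasible_const (μ := μ) c))
  simp [tradeoffObj, extExp_const]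

/-- A larger `c` is reached by a lump-sum transfer to the buyer, which keeps the allocation. -/
theorem tradeoffValue_monotone [IsProbabilityMeasure μ] (hg : Monotone g) :
    Monotone (tradeoffValue μ g) := by
  intro c c' hcc
  refine iSup_le fun x => iSup_le fun p => iSup_le fun h => ?_
  have hint : Integrable (fun v : Icc a b => (v : ℝ) * x v - p v) μ := by
    obtain ⟨u, -, hu, -⟩ := h.exists_utility
    simp_rw [← hu]
    exact u.continuous.integrable_of_hasCompactSupport (HasCompactSupport.of_compactSpace _)
  have e : ∀ v : Icc a b, (v : ℝ) * x v - (p v - (c' - c)) = ((v : ℝ) * x v - p v) + (c' - c) :=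
    fun v => by ring
  have hfeas : TightFeasible μ c' x fun v => p v - (c' - c) := by
    refine ⟨⟨h.1.1, fun v v' => by linarith [h.1.2 v v']⟩, ?_⟩
    simp_rw [e]
    rw [integral_add hint (integrable_const _), h.2]
    simp
  refine le_trans (extExp_mono_ae (Eventually.of_forall fun v => ?_)) (tradeoffObj_le_value hfeas)
  refine add_le_add le_rfl (hg ?_)
  linarith

/-- If `g` is `-∞` on negative numbers, then a feasible mechanism with an objective above `-∞` has
a nonnegative utility for every type. It has it almost surely; the support contains the lowest
type, which has the lowest utility. -/
theorem TightFeasible.utility_nonneg [IsProbabilityMeasure μ] (hg : UpperSemicontinuous g)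
    (hneg : ∀ t < 0, g t = ⊥) (hsupp : ∀ y : ℝ, a < y → 0 < μ {v | (v : ℝ) < y}) {c : ℝ}
    {x p : Icc a b → ℝ} (h : TightFeasible μ c x p) (hobj : tradeoffObj μ g x p ≠ ⊥)
    (v : Icc a b) : 0 ≤ (v : ℝ) * x v - p v := by
  obtain ⟨u, hu, hup, hx⟩ := h.exists_utility
  have hxm : Measurable x := (monotone_of_mem_subgrad hx).measurable
  have hm : Measurable fun v : Icc a b =>
      (((v : ℝ) * x v : ℝ) : EReal) + g ((v : ℝ) * x v - p v) := by
    simp_rw [← hup]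
    exact ((measurable_subtype_coe.mul hxm).coe_real_ereal).add
      (hg.measurable.comp u.continuous.measurable)
  have hae : ∀ᵐ w ∂μ, 0 ≤ u w := by
    filter_upwards [ae_ne_bot_of_extExp_ne_bot hm.aemeasurable hobj] with w hw
    by_contra hlt
    apply hw
    rw [← hup, hneg _ (not_le.1 hlt), EReal.add_bot]
  rw [← hup]
  by_contra hlt
  rw [not_le] at hlt
  set l : Icc a b := ⟨a, le_rfl, v.2.1.trans v.2.2⟩
  have hl : u l < 0 := (utilities_monotone hu.1 (show l ≤ v from v.2.1)).trans_lt hlt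
  have hpos := hsupp (a - u l) (by linarith)
  refine hpos.ne' (measure_mono_null (fun w hw => ?_) hae)
  have h1 := utilities_sub_le hu.1 l w
  have h2 : (w : ℝ) < a - u l := hw
  have h3 : |(w : ℝ) - (l : ℝ)| = (w : ℝ) - a := abs_of_nonneg (sub_nonneg.2 w.2.1)
  rw [h3] at h1
  change ¬ (0 ≤ u w)
  linarith

theorem tradeoffValue_of_neg [IsProbabilityMeasure μ] (hg : UpperSemicontinuous g)
    (hneg : ∀ t < 0, g t = ⊥) (hsupp : ∀ y : ℝ, a < y → 0 < μ {v | (v : ℝ) < y}) {c : ℝ}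
    (hc : c < 0) : tradeoffValue μ g c = ⊥ := by
  rw [eq_bot_iff]
  refine iSup_le fun x => iSup_le fun p => iSup_le fun h => ?_
  by_contra hobj
  rw [le_bot_iff] at hobj
  have h0 : 0 ≤ ∫ v, ((v : ℝ) * x v - p v) ∂μ :=
    integral_nonneg fun v => h.utility_nonneg hg hneg hsupp hobj v
  rw [h.2] at h0
  linarith

end Objective

/-! ### The cumulative tradeoff functions -/

/-- The regularity that passes from one cumulative tradeoff function to the next: upper
semicontinuous, bounded above, and `-∞` exactly on the negative numbers. -/
structure RegularTradeoff (g : ℝ → EReal) : Prop where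
  usc : UpperSemicontinuous g
  bounded : ∃ M : ℝ, ∀ t, g t ≤ M
  eq_bot : ∀ t < 0, g t = ⊥
  ne_bot : ∀ t, 0 ≤ t → g t ≠ ⊥

theorem regularTradeoff_terminal : RegularTradeoff terminalTradeoff where
  usc := by
    rw [upperSemicontinuous_iff_isClosed_preimage]
    intro y
    rcases eq_or_ne y ⊥ with rfl | hy
    · simp
    by_cases h0 : y ≤ 0
    · convert isClosed_Ici (a := (0 : ℝ))
      ext t
      by_cases ht : 0 ≤ t <;> simp [terminalTradeoff, ht, h0, hy]
    · convert isClosed_empty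
      ext t
      by_cases ht : 0 ≤ t <;> simp [terminalTradeoff, ht, h0, hy]
  bounded := ⟨0, fun t => by by_cases ht : 0 ≤ t <;> simp [terminalTradeoff, ht]⟩
  eq_bot := fun t ht => by simp [terminalTradeoff, not_le.2 ht]
  ne_bot := fun t ht => by simp [terminalTradeoff, ht]

theorem monotone_terminalTradeoff : Monotone terminalTradeoff := by
  intro s t hst
  by_cases hs : 0 ≤ s
  · simp [terminalTradeoff, hs, hs.trans hst]
  · simp [terminalTradeoff, hs]

theorem RegularTradeoff.dayTradeoff {G : ℝ → EReal} (hG : RegularTradeoff G) (i : ℕ) :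
    RegularTradeoff (dayTradeoff i G) := by
  rcases eq_or_ne i 0 with rfl | hi
  swap
  · have : _root_.dayTradeoff i G = G := funext fun u => by simp [_root_.dayTradeoff, hi]
    rwa [this]
  have hd : _root_.dayTradeoff 0 G = fun u => ((-u : ℝ) : EReal) + G u := funext fun u => by
    simp [_root_.dayTradeoff, sub_eq_add_neg, add_comm]
  obtain ⟨M, hM⟩ := hG.bounded
  have hbot : ∀ t < 0, ((-t : ℝ) : EReal) + G t = ⊥ := fun t ht => by
    rw [hG.eq_bot t ht, EReal.add_bot]
  rw [hd]
  refine ⟨upperSemicontinuous_coe_add (by fun_prop) hG.usc, ⟨M, fun t => ?_⟩, hbot, fun t ht => ?_⟩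
  · rcases lt_or_ge t 0 with ht | ht
    · exact (hbot t ht).trans_le bot_le
    · calc ((-t : ℝ) : EReal) + G t ≤ ((0 : ℝ) : EReal) + M :=
            add_le_add (EReal.coe_le_coe_iff.2 (by linarith)) (hM t)
        _ = M := by simp
  · simp only [ne_eq, EReal.add_eq_bot_iff, EReal.coe_ne_bot, hG.ne_bot t ht, or_self,
      not_false_eq_true]

theorem RegularTradeoff.tradeoffValue {a b : ℝ} {μ : Measure (Icc a b)} [IsProbabilityMeasure μ]
    [NullSingletonClass μ] (hsupp : ∀ y : ℝ, a < y → 0 < μ {v | (v : ℝ) < y}) {g : ℝ → EReal}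
    (hg : RegularTradeoff g) : RegularTradeoff (tradeoffValue μ g) := by
  obtain ⟨M, hM⟩ := hg.bounded
  exact ⟨upperSemicontinuous_tradeoffValue hg.usc hM, ⟨_, tradeoffValue_le hM⟩,
    fun t ht => tradeoffValue_of_neg hg.usc hg.eq_bot hsupp ht,
    fun t ht h => hg.ne_bot t ht (le_bot_iff.1 (h ▸ le_tradeoffValue t))⟩

theorem nullSingletonClass_of_map_absolutelyContinuous {a b : ℝ} {μ : Measure (Icc a b)}
    (h : μ.map Subtype.val ≪ (volume : Measure ℝ)) : NullSingletonClass μ := by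
  refine ⟨fun v => ?_⟩
  have h1 := h (show volume {(v : ℝ)} = 0 by simp)
  rw [Measure.map_apply measurable_subtype_coe (measurableSet_singleton _)] at h1
  exact measure_mono_null (fun w hw => congrArg Subtype.val hw) h1

section Cumulative

variable {k : ℕ} {lo hi : Fin k → ℝ} {μ : (i : Fin k) → Measure (Icc (lo i) (hi i))}

theorem cumTradeoff_of_lt {i : ℕ} (h : i < k) :
    cumTradeoff μ i = tradeoffValue (μ ⟨i, h⟩) (dayTradeoff i (cumTradeoff μ (i + 1))) := by
  rw [cumTradeoff, dif_pos h]

theorem cumTradeoff_of_le {i : ℕ} (h : k ≤ i) : cumTradeoff μ i = terminalTradeoff := by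
  rw [cumTradeoff, dif_neg (not_lt.2 h)]

variable [∀ i, IsProbabilityMeasure (μ i)]

/-- From the second day on, more promised utility never lowers the welfare that can be attained:
it can be paid out as a lump sum. -/
theorem monotone_cumTradeoff {i : ℕ} (hi : i ≠ 0) : Monotone (cumTradeoff μ i) := by
  induction hn : k - i generalizing i with
  | zero =>
    rw [cumTradeoff_of_le (Nat.sub_eq_zero_iff_le.1 hn)]
    exact monotone_terminalTradeoff
  | succ n ih =>
    have h : i < k := by omega
    rw [cumTradeoff_of_lt h]
    have : dayTradeoff i (cumTradeoff μ (i + 1)) = cumTradeoff μ (i + 1) :=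
      funext fun u => by simp [dayTradeoff, hi]
    rw [this]
    exact tradeoffValue_monotone (ih (by omega) (by omega))

variable [∀ i, NullSingletonClass (μ i)]

theorem regularTradeoff_cumTradeoff
    (hsupp : ∀ i, ∀ y : ℝ, lo i < y → 0 < μ i {v | (v : ℝ) < y}) (i : ℕ) :
    RegularTradeoff (cumTradeoff μ i) := by
  induction hn : k - i generalizing i with
  | zero =>
    rw [cumTradeoff_of_le (Nat.sub_eq_zero_iff_le.1 hn)]
    exact regularTradeoff_terminal
  | succ n ih =>
    have h : i < k := by omega
    rw [cumTradeoff_of_lt h]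
    exact ((ih (i + 1) (by omega)).dayTradeoff i).tradeoffValue (hsupp _)

/-- On the first day the promised utility is subtracted from a bounded welfare, so only a compact
range of promises matters. -/
theorem exists_maximizer_cumTradeoff (hk : 1 ≤ k)
    (hsupp : ∀ i, ∀ y : ℝ, lo i < y → 0 < μ i {v | (v : ℝ) < y}) :
    ∃ c₀ : ℝ, ∀ c : ℝ, cumTradeoff μ 0 c ≤ cumTradeoff μ 0 c₀ := by
  have hreg := regularTradeoff_cumTradeoff hsupp 0
  obtain ⟨M, hM⟩ := (regularTradeoff_cumTradeoff hsupp 1).bounded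
  have h0 : 0 < k := hk
  set B : ℝ := max |lo ⟨0, h0⟩| |hi ⟨0, h0⟩|
  have hbound : ∀ c, cumTradeoff μ 0 c ≤ ((B + M - c : ℝ) : EReal) := by
    intro c
    rw [cumTradeoff_of_lt h0]
    refine iSup_le fun x => iSup_le fun p => iSup_le fun h => ?_
    obtain ⟨u, huc, hu, -⟩ := h.exists_utility
    have hint : Integrable u (μ ⟨0, h0⟩) :=
      u.continuous.integrable_of_hasCompactSupport (HasCompactSupport.of_compactSpace _)
    have hI : ∫ v, (B + M - u v) ∂(μ ⟨0, h0⟩) = B + M - c := by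
      have hc : ∫ v, u v ∂(μ ⟨0, h0⟩) = c := huc.2
      rw [integral_sub (integrable_const _) hint, hc]
      simp
    rw [← hI, ← extExp_coe (f := fun v => B + M - u v) ((integrable_const _).sub hint)]
    refine extExp_mono_ae (Eventually.of_forall fun v => ?_)
    have hval : ((v : ℝ) * x v) ≤ B :=
      (le_abs_self _).trans (value_mul_alloc_le v (h.1.1 v))
    rw [← hu v]
    calc (((v : ℝ) * x v : ℝ) : EReal) + dayTradeoff 0 (cumTradeoff μ (0 + 1)) (u v)
        ≤ (B : EReal) + ((M : EReal) - (u v : EReal)) := by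
          refine add_le_add (EReal.coe_le_coe_iff.2 hval) ?_
          simp only [dayTradeoff, if_true]
          exact EReal.sub_le_sub (hM _) le_rfl
      _ = ((B + M - u v : ℝ) : EReal) := by
          rw [← EReal.coe_sub, ← EReal.coe_add]
          congr 1
          ring
  obtain ⟨r, hr⟩ : ∃ r : ℝ, cumTradeoff μ 0 0 = r :=
    ⟨_, (EReal.coe_toReal (ne_top_of_le_ne_top (EReal.coe_ne_top _) (hbound 0))
      (hreg.ne_bot 0 le_rfl)).symm⟩
  obtain ⟨c₀, -, hmax⟩ :=
    (hreg.usc.upperSemicontinuousOn (Icc 0 (max 0 (B + M - r)))).exists_isMaxOn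
    (nonempty_Icc.2 (le_max_left _ _)) isCompact_Icc
  have hmax' := isMaxOn_iff.1 hmax
  refine ⟨c₀, fun c => ?_⟩
  rcases lt_or_ge c 0 with hc | hc
  · rw [hreg.eq_bot c hc]
    exact bot_le
  rcases le_or_gt c (max 0 (B + M - r)) with hc' | hc'
  · exact hmax' c ⟨hc, hc'⟩
  · refine (hbound c).trans (le_trans ?_ (hmax' 0 ⟨le_rfl, le_max_left _ _⟩))
    rw [hr]
    have := (le_max_right 0 (B + M - r)).trans_lt hc'
    exact EReal.coe_le_coe_iff.2 (by linarith)

theorem exists_isPreprocessing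
    (hsupp : ∀ i, ∀ y : ℝ, lo i < y → 0 < μ i {v | (v : ℝ) < y}) :
    ∃ X P : (i : Fin k) → ℝ → Icc (lo i) (hi i) → ℝ, IsPreprocessing μ X P := by
  have h : ∀ i : Fin k, ∃ X P : ℝ → Icc (lo i) (hi i) → ℝ,
      (∀ c, IsTightOptimal (μ i) (dayTradeoff i (cumTradeoff μ (i + 1))) c (X c) (P c)) ∧
      (Measurable fun z : ℝ × Icc (lo i) (hi i) => X z.1 z.2) ∧
      Measurable fun z : ℝ × Icc (lo i) (hi i) => P z.1 z.2 := fun i => by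
    have hreg := (regularTradeoff_cumTradeoff (μ := μ) hsupp (i + 1)).dayTradeoff i
    obtain ⟨M, hM⟩ := hreg.bounded
    exact exists_measurable_isTightOptimal hreg.usc hM
  choose X P h1 h2 h3 using h
  exact ⟨X, P, h1, h2, h3⟩

end Cumulative

/-! ### Expectations given a history of reports -/

section History

variable {k : ℕ} {lo hi : Fin k → ℝ}

/-- The profile that agrees with `v` on the days before day `n` and with `w` from day `n` on. -/
def spliceAt (n : ℕ) (v w : Profile lo hi) : Profile lo hi :=
  fun j => if (j : ℕ) < n then v j else w j

theorem splice_eq_spliceAt (i : Fin k) (v w : Profile lo hi) :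
    splice i v w = spliceAt ((i : ℕ) + 1) v w := by
  funext j
  simp only [splice, spliceAt, Fin.le_def, Nat.lt_succ_iff]

theorem spliceAt_zero (v w : Profile lo hi) : spliceAt 0 v w = w := by
  funext j
  simp [spliceAt]

theorem spliceAt_update (n : Fin k) (v w : Profile lo hi) (t : Icc (lo n) (hi n)) :
    spliceAt n v (Function.update w n t) = spliceAt ((n : ℕ) + 1) (Function.update v n t) w := by
  funext j
  rcases eq_or_ne j n with rfl | hj
  · simp [spliceAt]
  · have : (j : ℕ) ≠ n := fun h => hj (Fin.ext h)
    have h2 : (j : ℕ) < n + 1 ↔ (j : ℕ) < n := by omega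
    simp only [spliceAt, Function.update_of_ne hj, h2]

theorem HistoryAdapted.spliceAt_eq {F : Fin k → Profile lo hi → ℝ} (hF : HistoryAdapted F)
    {i : Fin k} {n : ℕ} (hin : (i : ℕ) < n) (v w : Profile lo hi) :
    F i (spliceAt n v w) = F i v :=
  hF i _ _ fun _ hj => if_pos (lt_of_le_of_lt (Fin.le_def.1 hj) hin)

theorem measurable_spliceAt (n : ℕ) (v : Profile lo hi) : Measurable (spliceAt n v) := by
  refine measurable_pi_iff.2 fun j => ?_
  by_cases h : (j : ℕ) < n
  · simp only [spliceAt, h, if_true]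
    exact measurable_const
  · simp only [spliceAt, h, if_false]
    exact measurable_pi_apply j

variable (μ : (i : Fin k) → Measure (Icc (lo i) (hi i)))

/-- The expected sum of the terms `F j` over the days `j ≥ n`, given the history `v` of the days
before day `n`. -/
def tailExp (F : Fin k → Profile lo hi → ℝ) (n : ℕ) (v : Profile lo hi) : ℝ :=
  ∫ w, ∑ j with n ≤ (j : Fin k).val, F j (spliceAt n v w) ∂(Measure.pi μ)

/-- The terms of `F` from day `n` on are integrable given every history of the earlier days. -/
def HistoryIntegrable (F : Fin k → Profile lo hi → ℝ) : Prop :=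
  ∀ (n : ℕ) (v : Profile lo hi) (j : Fin k), n ≤ j →
    Integrable (fun w => F j (spliceAt n v w)) (Measure.pi μ)

variable {μ}

theorem tailExp_of_le (F : Fin k → Profile lo hi → ℝ) {n : ℕ} (h : k ≤ n) (v : Profile lo hi) :
    tailExp μ F n v = 0 := by
  have : (Finset.univ.filter fun j : Fin k => n ≤ j.val) = ∅ :=
    Finset.filter_eq_empty_iff.2 fun j _ => by omega
  simp [tailExp, this]

theorem futureUtility_eq_tailExp (x p : Fin k → Profile lo hi → ℝ) (i : Fin k)
    (v : Profile lo hi) :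
    futureUtility μ x p i v = tailExp μ (stageUtility x p) ((i : ℕ) + 1) v := by
  have : Finset.Ioi i = Finset.univ.filter fun j : Fin k => (i : ℕ) + 1 ≤ j.val := by
    ext j
    rw [Finset.mem_Ioi, Finset.mem_filter, Fin.lt_def, Nat.succ_le_iff]
    simp
  simp only [futureUtility, tailExp, this, splice_eq_spliceAt]

variable [∀ i, IsProbabilityMeasure (μ i)]

/-- Redrawing one coordinate independently does not change the distribution of the profile. -/
theorem measurePreserving_update (n : Fin k) :
    MeasurePreserving
      (fun z : Icc (lo n) (hi n) × Profile lo hi => Function.update z.2 n z.1)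
      ((μ n).prod (Measure.pi μ)) (Measure.pi μ) := by
  have hmeas : Measurable
      fun z : Icc (lo n) (hi n) × Profile lo hi => Function.update z.2 n z.1 := by
    refine measurable_pi_iff.2 fun j => ?_
    rcases eq_or_ne j n with rfl | hj
    · simpa using measurable_fst
    · simp only [Function.update_of_ne hj]
      exact (measurable_pi_apply j).comp measurable_snd
  refine ⟨hmeas, (Measure.pi_eq fun s hs => ?_).symm⟩
  rw [Measure.map_apply hmeas (MeasurableSet.univ_pi hs)]
  have hpre : (fun z : Icc (lo n) (hi n) × Profile lo hi => Function.update z.2 n z.1) ⁻¹'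
      univ.pi s = s n ×ˢ univ.pi (Function.update s n univ) := by
    ext z
    simp only [mem_preimage, mem_univ_pi, mem_prod]
    constructor
    · intro h
      refine ⟨by simpa using h n, fun j => ?_⟩
      rcases eq_or_ne j n with rfl | hj
      · simp
      · simpa [hj] using h j
    · rintro ⟨h1, h2⟩ j
      rcases eq_or_ne j n with rfl | hj
      · simpa using h1
      · simpa [hj] using h2 j
  rw [hpre, Measure.prod_prod, Measure.pi_pi, ← Finset.mul_prod_erase _ _ (Finset.mem_univ n),
    ← Finset.mul_prod_erase Finset.univ (fun i => μ i (s i)) (Finset.mem_univ n)]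
  simp only [Function.update_self, measure_univ, one_mul]
  congr 1
  refine Finset.prod_congr rfl fun j hj => ?_
  rw [Function.update_of_ne (Finset.ne_of_mem_erase hj)]

/-- The tower property: first take the expectation given the report of day `n`, then average over
this report. -/
theorem tailExp_step {F : Fin k → Profile lo hi → ℝ} (hF : HistoryAdapted F)
    (hint : HistoryIntegrable μ F) (n : Fin k) (v : Profile lo hi) :
    Integrable (fun t => F n (Function.update v n t)
      + tailExp μ F ((n : ℕ) + 1) (Function.update v n t)) (μ n) ∧
    tailExp μ F n v = ∫ t, (F n (Function.update v n t)
      + tailExp μ F ((n : ℕ) + 1) (Function.update v n t)) ∂(μ n) := by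
  set f : Profile lo hi → ℝ := fun w => ∑ j with (n : ℕ) ≤ (j : Fin k).val, F j (spliceAt n v w)
    with hf
  have hfint : Integrable f (Measure.pi μ) :=
    integrable_finsetSum _ fun j hj => hint n v j (Finset.mem_filter.1 hj).2
  have hmp := measurePreserving_update (μ := μ) n
  have hprod : Integrable (fun z : Icc (lo n) (hi n) × Profile lo hi =>
      f (Function.update z.2 n z.1)) ((μ n).prod (Measure.pi μ)) :=
    hmp.integrable_comp_of_integrable hfint
  have hset : (Finset.univ.filter fun j : Fin k => (n : ℕ) ≤ j.val)
      = insert n (Finset.univ.filter fun j : Fin k => (n : ℕ) + 1 ≤ j.val) := by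
    ext j
    simp only [Finset.mem_filter, Finset.mem_univ, true_and, Finset.mem_insert, Fin.ext_iff]
    omega
  have hinner : ∀ t, ∫ w, f (Function.update w n t) ∂(Measure.pi μ) =
      F n (Function.update v n t) + tailExp μ F ((n : ℕ) + 1) (Function.update v n t) := by
    intro t
    have h1 : ∀ w, f (Function.update w n t) = F n (Function.update v n t) +
        ∑ j with (n : ℕ) + 1 ≤ (j : Fin k).val,
          F j (spliceAt ((n : ℕ) + 1) (Function.update v n t) w) := by
      intro w
      simp only [hf, spliceAt_update, hset]
      rw [Finset.sum_insert (by simp), hF.spliceAt_eq (Nat.lt_succ_self _)]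
    simp_rw [h1]
    rw [integral_add (integrable_const _) (integrable_finsetSum _ fun j hj =>
      hint _ _ j (Finset.mem_filter.1 hj).2)]
    simp [tailExp]
  constructor
  · have := hprod.integral_prod_left
    simpa only [hinner] using this
  · have h1 : tailExp μ F n v = ∫ w, f w ∂(Measure.pi μ) := rfl
    rw [h1, ← hmp.map_eq, integral_map hmp.measurable.aemeasurable
      (by rw [hmp.map_eq]; exact hfint.aestronglyMeasurable), integral_prod _ hprod]
    simp only [hinner]

theorem historyIntegrable_of_bounded {F : Fin k → Profile lo hi → ℝ}
    (hm : ∀ j, Measurable (F j)) {R : ℝ} (hR : ∀ j v, |F j v| ≤ R) : HistoryIntegrable μ F :=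
  fun n v j _ => Integrable.of_bound
    ((hm j).comp (measurable_spliceAt n v)).aestronglyMeasurable R
    (Eventually.of_forall fun _ => hR j _)

end History

/-! ### The upper bound on the revenue of a feasible mechanism -/

section UpperBound

variable {k : ℕ} {lo hi : Fin k → ℝ} {μ : (i : Fin k) → Measure (Icc (lo i) (hi i))}

/-- The surplus `v_j x_j` generated on day `j`. -/
def surplus (x : Fin k → Profile lo hi → ℝ) (j : Fin k) (v : Profile lo hi) : ℝ :=
  (v j : ℝ) * x j v

theorem historyAdapted_surplus {x : Fin k → Profile lo hi → ℝ} (hx : HistoryAdapted x) :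
    HistoryAdapted (surplus x) := fun i v w h => by
  simp only [surplus, hx i v w h, h i le_rfl]

theorem historyAdapted_stageUtility {x p : Fin k → Profile lo hi → ℝ} (hx : HistoryAdapted x)
    (hp : HistoryAdapted p) : HistoryAdapted (stageUtility x p) := fun i v w h => by
  simp only [stageUtility, hx i v w h, hp i v w h, h i le_rfl]

variable {x p : Fin k → Profile lo hi → ℝ}

theorem IsMechanism.historyIntegrable_pay (h : IsMechanism μ x p) : HistoryIntegrable μ p := by
  intro n v j hj
  rcases n with _ | n
  · simpa only [spliceAt_zero] using h.integrable_pay j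
  · have := h.integrable_future ⟨n, lt_of_lt_of_le hj j.2.le⟩ j v (Fin.lt_def.2 hj)
    simpa only [splice_eq_spliceAt] using this

variable [∀ i, IsProbabilityMeasure (μ i)]

theorem historyIntegrable_surplus (hx : ∀ i, Measurable (x i))
    (hmem : ∀ i v, 0 ≤ x i v ∧ x i v ≤ 1) : HistoryIntegrable μ (surplus x) := by
  refine historyIntegrable_of_bounded (R := ∑ i, max |lo i| |hi i|)
    (fun j => (measurable_subtype_coe.comp (measurable_pi_apply j)).mul (hx j)) fun j v => ?_
  refine (value_mul_alloc_le (v j) (hmem j v)).trans ?_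
  exact Finset.single_le_sum (f := fun i => max |lo i| |hi i|)
    (fun i _ => le_max_of_le_left (abs_nonneg _)) (Finset.mem_univ j)

theorem IsMechanism.historyIntegrable_stageUtility (h : IsMechanism μ x p) :
    HistoryIntegrable μ (stageUtility x p) := fun n v j hj =>
  (historyIntegrable_surplus h.measurable_alloc h.alloc_mem n v j hj).sub
    (h.historyIntegrable_pay n v j hj)

/-- Revenue is welfare minus the expected utility of the buyer. -/
theorem IsMechanism.revenue_eq (h : IsMechanism μ x p) (v : Profile lo hi) :
    revenue μ p = tailExp μ (surplus x) 0 v - tailExp μ (stageUtility x p) 0 v := by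
  have hs := historyIntegrable_surplus (μ := μ) h.measurable_alloc h.alloc_mem
  have hu := h.historyIntegrable_stageUtility
  unfold tailExp
  rw [← integral_sub (integrable_finsetSum _ fun j _ => hs 0 v j (Nat.zero_le _))
    (integrable_finsetSum _ fun j _ => hu 0 v j (Nat.zero_le _))]
  simp [spliceAt_zero, surplus, stageUtility, revenue]

/-- Given the history `v` of the days before day `n`, the allocation of day `n` and the total
utility from day `n` on form a static incentive compatible mechanism, whose expected utility is the
utility promised by the history. -/
theorem Feasible.tightFeasible_day (h : Feasible μ x p) (n : Fin k) (v : Profile lo hi) :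
    TightFeasible (μ n) (tailExp μ (stageUtility x p) n v)
      (fun t => x n (Function.update v n t))
      (fun t => (t : ℝ) * x n (Function.update v n t) - (stageUtility x p n (Function.update v n t)
        + tailExp μ (stageUtility x p) ((n : ℕ) + 1) (Function.update v n t))) := by
  obtain ⟨hmech, hIC, -⟩ := h
  refine ⟨⟨fun t => hmech.alloc_mem n _, fun t t' => ?_⟩, ?_⟩
  · have := hIC n (Function.update v n t) t'
    simp only [Function.update_idem, Function.update_self, futureUtility_eq_tailExp] at this
    simp only [stageUtility, Function.update_self]
    linarith
  · rw [(tailExp_step (historyAdapted_stageUtility hmech.adapted_alloc hmech.adapted_pay)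
      hmech.historyIntegrable_stageUtility n v).2]
    simp

/-- One step of the backward induction for the upper bound. Individual rationality enters here:
the total utility from day `n` on is at least the utility from day `n + 1` on, and the next
cumulative tradeoff function is monotone. -/
theorem Feasible.welfare_step (h : Feasible μ x p) (n : Fin k)
    (ih : ∀ v, ((tailExp μ (surplus x) ((n : ℕ) + 1) v : ℝ) : EReal) ≤
      cumTradeoff μ ((n : ℕ) + 1) (tailExp μ (stageUtility x p) ((n : ℕ) + 1) v))
    (v : Profile lo hi) :
    ((tailExp μ (surplus x) n v
        - (if (n : ℕ) = 0 then tailExp μ (stageUtility x p) n v else 0) : ℝ) : EReal)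
      ≤ cumTradeoff μ n (tailExp μ (stageUtility x p) n v) := by
  have hfeas := h.tightFeasible_day n v
  obtain ⟨hmech, -, hIR⟩ := h
  obtain ⟨hWi, hW⟩ := tailExp_step (historyAdapted_surplus hmech.adapted_alloc)
    (historyIntegrable_surplus (μ := μ) hmech.measurable_alloc hmech.alloc_mem) n v
  obtain ⟨hCi, hC⟩ := tailExp_step
    (historyAdapted_stageUtility hmech.adapted_alloc hmech.adapted_pay)
    hmech.historyIntegrable_stageUtility n v
  rw [cumTradeoff_of_lt n.2]
  refine le_trans ?_ (tradeoffObj_le_value hfeas)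
  set u : Icc (lo n) (hi n) → ℝ := fun t => stageUtility x p n (Function.update v n t)
    + tailExp μ (stageUtility x p) ((n : ℕ) + 1) (Function.update v n t) with hu
  set s : Icc (lo n) (hi n) → ℝ := fun t => surplus x n (Function.update v n t)
    + tailExp μ (surplus x) ((n : ℕ) + 1) (Function.update v n t) with hs
  have hCi' : Integrable (fun t => if (n : ℕ) = 0 then u t else 0) (μ n) := by
    by_cases h0 : (n : ℕ) = 0
    · simpa only [h0, if_true] using hCi
    · simp only [h0, if_false]
      exact integrable_zero _ _ _
  have hint : tailExp μ (surplus x) n v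
      - (if (n : ℕ) = 0 then tailExp μ (stageUtility x p) n v else 0)
      = ∫ t, (s t - if (n : ℕ) = 0 then u t else 0) ∂(μ n) := by
    rw [integral_sub hWi hCi', hW]
    by_cases h0 : (n : ℕ) = 0
    · rw [if_pos h0, hC]
      simp only [h0, if_true, hu]
    · simp [h0]
  rw [hint, ← extExp_coe (f := fun t => s t - if (n : ℕ) = 0 then u t else 0) (hWi.sub hCi')]
  refine extExp_mono_ae (Eventually.of_forall fun t => ?_)
  -- the report `t` leads to the welfare bound at the next promise, which is at most `u t`
  have hstep : ((tailExp μ (surplus x) ((n : ℕ) + 1) (Function.update v n t) : ℝ) : EReal) ≤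
      cumTradeoff μ ((n : ℕ) + 1) (u t) :=
    (ih _).trans (monotone_cumTradeoff (μ := μ) (Nat.succ_ne_zero _)
      (le_add_of_nonneg_left (hIR n (Function.update v n t))))
  have e : (t : ℝ) * x n (Function.update v n t)
      - ((t : ℝ) * x n (Function.update v n t) - u t) = u t := by ring
  change _ ≤ _ + dayTradeoff n (cumTradeoff μ (n + 1)) ((t : ℝ) * x n (Function.update v n t)
      - ((t : ℝ) * x n (Function.update v n t) - u t))
  rw [e, hs]
  simp only [surplus, Function.update_self, dayTradeoff]
  by_cases h0 : (n : ℕ) = 0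
  · rw [if_pos h0, if_pos h0, add_sub_assoc, EReal.coe_add, EReal.coe_sub]
    exact add_le_add le_rfl (EReal.sub_le_sub hstep le_rfl)
  · rw [if_neg h0, if_neg h0, sub_zero, EReal.coe_add]
    exact add_le_add le_rfl hstep

theorem Feasible.welfare_le (h : Feasible μ x p) {n : ℕ} (hn : n ≠ 0) (v : Profile lo hi) :
    ((tailExp μ (surplus x) n v : ℝ) : EReal) ≤
      cumTradeoff μ n (tailExp μ (stageUtility x p) n v) := by
  induction hm : k - n generalizing n v with
  | zero =>
    have hkn := Nat.sub_eq_zero_iff_le.1 hm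
    simp [tailExp_of_le _ hkn, cumTradeoff_of_le hkn, terminalTradeoff]
  | succ m ih =>
    have hnk : n < k := by omega
    have := h.welfare_step ⟨n, hnk⟩ (fun w => ih (Nat.succ_ne_zero n) w (by omega)) v
    simpa [hn] using this

theorem Feasible.revenue_le (h : Feasible μ x p) (hk : 1 ≤ k) (v : Profile lo hi) :
    (revenue μ p : EReal) ≤ cumTradeoff μ 0 (tailExp μ (stageUtility x p) 0 v) := by
  have := h.welfare_step ⟨0, hk⟩ (fun w => h.welfare_le (Nat.succ_ne_zero 0) w) v
  rw [h.1.revenue_eq v]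
  simpa using this

end UpperBound

/-! ### The forward mechanism -/

section Forward

variable {k : ℕ} {lo hi : Fin k → ℝ} {μ : (i : Fin k) → Measure (Icc (lo i) (hi i))}
  {X P : (i : Fin k) → ℝ → Icc (lo i) (hi i) → ℝ} {c₀ : ℝ}

theorem mechState_succ (i : Fin k) (v : Profile lo hi) :
    mechState X P c₀ v ((i : ℕ) + 1) = (v i : ℝ) * X i (mechState X P c₀ v i) (v i)
      - P i (mechState X P c₀ v i) (v i) := by
  rw [mechState, dif_pos i.2]

theorem mechState_congr {n : ℕ} {v w : Profile lo hi} (h : ∀ j : Fin k, (j : ℕ) < n → v j = w j) :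
    mechState X P c₀ v n = mechState X P c₀ w n := by
  induction n with
  | zero => rfl
  | succ n ih =>
    have ih' := ih fun j hj => h j (hj.trans (Nat.lt_succ_self n))
    by_cases hn : n < k
    · rw [mechState_succ ⟨n, hn⟩, mechState_succ ⟨n, hn⟩]
      simp only [ih', h ⟨n, hn⟩ (Nat.lt_succ_self n)]
    · rw [mechState, mechState, dif_neg hn, dif_neg hn, ih']

theorem mechState_update (n : Fin k) (v : Profile lo hi) (t : Icc (lo n) (hi n)) :
    mechState X P c₀ (Function.update v n t) n = mechState X P c₀ v n :=
  mechState_congr fun _ hj => Function.update_of_ne (fun h => hj.ne (congrArg Fin.val h)) _ _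

theorem IsPreprocessing.measurable_mechState (h : IsPreprocessing μ X P) (n : ℕ) :
    Measurable fun v => mechState X P c₀ v n := by
  induction n with
  | zero => exact measurable_const
  | succ n ih =>
    by_cases hn : n < k
    · have hz : Measurable fun v : Profile lo hi => (mechState X P c₀ v n, v ⟨n, hn⟩) :=
        ih.prodMk (measurable_pi_apply _)
      simp only [mechState_succ ⟨n, hn⟩]
      exact ((measurable_subtype_coe.comp (measurable_pi_apply _)).mul
        ((h.measurable_alloc ⟨n, hn⟩).comp hz)).sub ((h.measurable_pay ⟨n, hn⟩).comp hz)
    · simp only [mechState, dif_neg hn]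
      exact ih

theorem IsPreprocessing.measurable_forwardAlloc (h : IsPreprocessing μ X P) (i : Fin k) :
    Measurable (forwardAlloc X P c₀ i) :=
  (h.measurable_alloc i).comp ((h.measurable_mechState i).prodMk (measurable_pi_apply i))

theorem IsPreprocessing.measurable_forwardPay (h : IsPreprocessing μ X P) (i : Fin k) :
    Measurable (forwardPay X P c₀ i) := by
  unfold forwardPay
  split_ifs
  · exact (measurable_subtype_coe.comp (measurable_pi_apply i)).mul (h.measurable_forwardAlloc i)
  · exact (h.measurable_pay i).comp ((h.measurable_mechState i).prodMk (measurable_pi_apply i))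

theorem IsPreprocessing.forwardAlloc_mem (h : IsPreprocessing μ X P) (i : Fin k)
    (v : Profile lo hi) : 0 ≤ forwardAlloc X P c₀ i v ∧ forwardAlloc X P c₀ i v ≤ 1 :=
  (h.optimal i _).1.1.1 _

theorem historyAdapted_forwardAlloc : HistoryAdapted (forwardAlloc X P c₀) := fun i v w h => by
  simp only [forwardAlloc, h i le_rfl,
    mechState_congr (X := X) (P := P) (c₀ := c₀) fun j (hj : (j : ℕ) < i) =>
      h j (Fin.le_def.2 hj.le)]

theorem historyAdapted_forwardPay : HistoryAdapted (forwardPay X P c₀) := fun i v w h => by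
  simp only [forwardPay, h i le_rfl,
    mechState_congr (X := X) (P := P) (c₀ := c₀) fun j (hj : (j : ℕ) < i) =>
      h j (Fin.le_def.2 hj.le)]

/-- The buyer receives no utility before the last day, when he receives the final state. -/
theorem stageUtility_forward (i : Fin k) (v : Profile lo hi) :
    stageUtility (forwardAlloc X P c₀) (forwardPay X P c₀) i v =
      if (i : ℕ) + 1 < k then 0 else mechState X P c₀ v ((i : ℕ) + 1) := by
  rw [mechState_succ]
  simp only [stageUtility, forwardAlloc, forwardPay]
  split_ifs
  · ring
  · rfl

variable [∀ i, IsProbabilityMeasure (μ i)]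

theorem IsPreprocessing.exists_mechState_bound (h : IsPreprocessing μ X P) (n : ℕ) :
    ∃ R : ℝ, ∀ v, |mechState X P c₀ v n| ≤ R := by
  induction n with
  | zero => exact ⟨|c₀|, fun v => le_rfl⟩
  | succ n ih =>
    obtain ⟨R, hR⟩ := ih
    by_cases hn : n < k
    · refine ⟨R + (hi ⟨n, hn⟩ - lo ⟨n, hn⟩), fun v => ?_⟩
      rw [mechState_succ ⟨n, hn⟩]
      obtain ⟨u, hu, hup, -⟩ := (h.optimal ⟨n, hn⟩ (mechState X P c₀ v n)).1.exists_utility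
      have h1 := abs_utility_sub_integral_le (μ := μ ⟨n, hn⟩) hu.1 (v ⟨n, hn⟩)
      have h2 : ∫ t, u t ∂(μ ⟨n, hn⟩) = mechState X P c₀ v n := hu.2
      rw [h2, hup] at h1
      have h3 := abs_add_le ((v ⟨n, hn⟩ : ℝ) * X ⟨n, hn⟩ (mechState X P c₀ v n) (v ⟨n, hn⟩)
        - P ⟨n, hn⟩ (mechState X P c₀ v n) (v ⟨n, hn⟩) - mechState X P c₀ v n)
        (mechState X P c₀ v n)
      rw [sub_add_cancel] at h3
      linarith [hR v]
    · simp only [mechState, dif_neg hn]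
      exact ⟨R, hR⟩

theorem IsPreprocessing.historyIntegrable_stageUtility (h : IsPreprocessing μ X P) :
    HistoryIntegrable μ (stageUtility (forwardAlloc X P c₀) (forwardPay X P c₀)) := by
  obtain ⟨R, hR⟩ := h.exists_mechState_bound (c₀ := c₀) k
  refine historyIntegrable_of_bounded (R := R) (fun j => ?_) fun j v => ?_
  · exact ((measurable_subtype_coe.comp (measurable_pi_apply j)).mul
      (h.measurable_forwardAlloc j)).sub (h.measurable_forwardPay j)
  · rw [stageUtility_forward]
    split_ifs with hj
    · simpa using (abs_nonneg _).trans (hR v)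
    · have : (j : ℕ) + 1 = k := by omega
      rw [this]
      exact hR v

theorem IsPreprocessing.isMechanism_forward (h : IsPreprocessing μ X P) :
    IsMechanism μ (forwardAlloc X P c₀) (forwardPay X P c₀) := by
  have hint : HistoryIntegrable μ (forwardPay X P c₀) := by
    intro n v j hj
    have := (historyIntegrable_surplus (μ := μ) (x := forwardAlloc X P c₀)
      h.measurable_forwardAlloc h.forwardAlloc_mem n v j hj).sub
      (h.historyIntegrable_stageUtility (c₀ := c₀) n v j hj)
    refine this.congr (Eventually.of_forall fun w => ?_)
    simp [surplus, stageUtility]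
  refine ⟨historyAdapted_forwardAlloc, historyAdapted_forwardPay, h.measurable_forwardAlloc,
    h.measurable_forwardPay, h.forwardAlloc_mem, fun i => ?_, fun i j v hij => ?_⟩
  · have := hint 0 (fun i => ?_) i (Nat.zero_le _)
    · simpa only [spliceAt_zero] using this
    · exact (nonempty_of_isProbabilityMeasure (μ i)).some
  · simpa only [splice_eq_spliceAt] using hint ((i : ℕ) + 1) v j (Fin.lt_def.1 hij)

/-- The state is the promised utility: by the tightness of the static problems, the expected
utility from day `n` on is the state at the beginning of day `n`. -/
theorem IsPreprocessing.tailExp_stageUtility_forward (h : IsPreprocessing μ X P) {n : ℕ}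
    (hn : n < k) (v : Profile lo hi) :
    tailExp μ (stageUtility (forwardAlloc X P c₀) (forwardPay X P c₀)) n v
      = mechState X P c₀ v n := by
  induction hm : k - n generalizing n v with
  | zero => omega
  | succ m ih =>
    rw [(tailExp_step (historyAdapted_stageUtility historyAdapted_forwardAlloc
      historyAdapted_forwardPay) h.historyIntegrable_stageUtility ⟨n, hn⟩ v).2]
    have hstep : ∀ w : Profile lo hi,
        stageUtility (forwardAlloc X P c₀) (forwardPay X P c₀) ⟨n, hn⟩ w
        + tailExp μ (stageUtility (forwardAlloc X P c₀) (forwardPay X P c₀)) (n + 1) w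
        = mechState X P c₀ w (n + 1) := by
      intro w
      rw [stageUtility_forward]
      by_cases hlast : n + 1 < k
      · simp only [hlast, if_true, zero_add]
        exact ih hlast w (by omega)
      · simp only [hlast, if_false, tailExp_of_le _ (not_lt.1 hlast), add_zero]
    simp only [hstep]
    rw [← (h.optimal ⟨n, hn⟩ (mechState X P c₀ v n)).1.2]
    refine integral_congr_ae (Eventually.of_forall fun t => ?_)
    simp only [mechState_succ ⟨n, hn⟩, mechState_update ⟨n, hn⟩ v t, Function.update_self]

theorem IsPreprocessing.stageUtility_add_futureUtility (h : IsPreprocessing μ X P) (i : Fin k)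
    (v : Profile lo hi) :
    stageUtility (forwardAlloc X P c₀) (forwardPay X P c₀) i v
      + futureUtility μ (forwardAlloc X P c₀) (forwardPay X P c₀) i v
      = mechState X P c₀ v ((i : ℕ) + 1) := by
  rw [futureUtility_eq_tailExp, stageUtility_forward]
  by_cases hlast : (i : ℕ) + 1 < k
  · rw [if_pos hlast, h.tailExp_stageUtility_forward hlast, zero_add]
  · rw [if_neg hlast, tailExp_of_le _ (not_lt.1 hlast), add_zero]

/-- A dynamic misreport on day `i` is a misreport in the static mechanism of the current state. -/
theorem IsPreprocessing.periodicIC_forward (h : IsPreprocessing μ X P) :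
    PeriodicIC μ (forwardAlloc X P c₀) (forwardPay X P c₀) := by
  intro i v t
  have h1 := h.stageUtility_add_futureUtility (c₀ := c₀) i v
  have h2 := h.stageUtility_add_futureUtility (c₀ := c₀) i (Function.update v i t)
  have h3 := (h.optimal i (mechState X P c₀ v i)).1.1.2 (v i) t
  rw [mechState_succ] at h1 h2
  have h4 : forwardAlloc X P c₀ i (Function.update v i t) = X i (mechState X P c₀ v i) t := by
    simp only [forwardAlloc, mechState_update, Function.update_self]
  simp only [mechState_update, Function.update_self, stageUtility, h4] at h1 h2 ⊢
  linarith

/-- One step of the backward induction for the welfare of the forward mechanism. -/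
theorem IsPreprocessing.welfare_step (h : IsPreprocessing μ X P) (n : Fin k)
    (ih : ∀ v, ((tailExp μ (surplus (forwardAlloc X P c₀)) ((n : ℕ) + 1) v : ℝ) : EReal) =
      cumTradeoff μ ((n : ℕ) + 1) (mechState X P c₀ v ((n : ℕ) + 1)))
    (v : Profile lo hi) :
    ((tailExp μ (surplus (forwardAlloc X P c₀)) n v
        - (if (n : ℕ) = 0 then mechState X P c₀ v n else 0) : ℝ) : EReal)
      = cumTradeoff μ n (mechState X P c₀ v n) := by
  obtain ⟨hWi, hW⟩ := tailExp_step (historyAdapted_surplus historyAdapted_forwardAlloc)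
    (historyIntegrable_surplus (μ := μ) (x := forwardAlloc X P c₀) h.measurable_forwardAlloc
      h.forwardAlloc_mem) n v
  have hopt := h.optimal n (mechState X P c₀ v n)
  rw [cumTradeoff_of_lt n.2, ← hopt.obj_eq]
  set c := mechState X P c₀ v n with hc
  set u : Icc (lo n) (hi n) → ℝ := fun t => (t : ℝ) * X n c t - P n c t with hu
  have hui : Integrable u (μ n) := by
    obtain ⟨w, -, hw, -⟩ := hopt.1.exists_utility
    simp only [hu, ← hw]
    exact w.continuous.integrable_of_hasCompactSupport (HasCompactSupport.of_compactSpace _)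
  have hui' : Integrable (fun t => if (n : ℕ) = 0 then u t else 0) (μ n) := by
    by_cases h0 : (n : ℕ) = 0
    · simpa only [h0, if_true] using hui
    · simp only [h0, if_false]
      exact integrable_zero _ _ _
  set s : Icc (lo n) (hi n) → ℝ := fun t => surplus (forwardAlloc X P c₀) n (Function.update v n t)
    + tailExp μ (surplus (forwardAlloc X P c₀)) ((n : ℕ) + 1) (Function.update v n t) with hs
  have hint : tailExp μ (surplus (forwardAlloc X P c₀)) n v - (if (n : ℕ) = 0 then c else 0)
      = ∫ t, (s t - if (n : ℕ) = 0 then u t else 0) ∂(μ n) := by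
    rw [integral_sub hWi hui', hW]
    by_cases h0 : (n : ℕ) = 0
    · rw [if_pos h0, ← hopt.1.2]
      simp only [h0, if_true, hu]
    · simp [h0]
  rw [hint, ← extExp_coe (f := fun t => s t - if (n : ℕ) = 0 then u t else 0) (hWi.sub hui')]
  refine extExp_congr_ae (Eventually.of_forall fun t => ?_)
  have hsucc : mechState X P c₀ (Function.update v n t) ((n : ℕ) + 1) = u t := by
    rw [mechState_succ, mechState_update, Function.update_self]
  have hstep := ih (Function.update v n t)
  rw [hsucc] at hstep
  simp only [hs, surplus, forwardAlloc, mechState_update, Function.update_self, dayTradeoff,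
    ← hc] at hstep ⊢
  change _ = _ + if (n : ℕ) = 0 then cumTradeoff μ (n + 1) (u t) - (u t : EReal)
    else cumTradeoff μ (n + 1) (u t)
  rw [← hstep]
  by_cases h0 : (n : ℕ) = 0
  · rw [if_pos h0, if_pos h0, add_sub_assoc, EReal.coe_add, EReal.coe_sub]
  · rw [if_neg h0, if_neg h0, sub_zero, EReal.coe_add]

variable [∀ i, NullSingletonClass (μ i)]

theorem IsPreprocessing.mechState_nonneg (h : IsPreprocessing μ X P)
    (hsupp : ∀ i, ∀ y : ℝ, lo i < y → 0 < μ i {v | (v : ℝ) < y}) (hc₀ : 0 ≤ c₀)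
    (v : Profile lo hi) (n : ℕ) : 0 ≤ mechState X P c₀ v n := by
  induction n with
  | zero => exact hc₀
  | succ n ih =>
    by_cases hn : n < k
    · rw [mechState_succ ⟨n, hn⟩]
      have hreg := (regularTradeoff_cumTradeoff (μ := μ) hsupp (n + 1)).dayTradeoff n
      have hopt := h.optimal ⟨n, hn⟩ (mechState X P c₀ v n)
      refine hopt.1.utility_nonneg hreg.usc hreg.eq_bot (hsupp _) ?_ _
      rw [hopt.obj_eq]
      exact (hreg.tradeoffValue (hsupp ⟨n, hn⟩)).ne_bot _ ih
    · simp only [mechState, dif_neg hn]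
      exact ih

theorem IsPreprocessing.feasible_forward (h : IsPreprocessing μ X P)
    (hsupp : ∀ i, ∀ y : ℝ, lo i < y → 0 < μ i {v | (v : ℝ) < y}) (hc₀ : 0 ≤ c₀) :
    Feasible μ (forwardAlloc X P c₀) (forwardPay X P c₀) := by
  refine ⟨h.isMechanism_forward, h.periodicIC_forward, fun i v => ?_⟩
  rw [stageUtility_forward]
  split_ifs
  · exact le_rfl
  · exact h.mechState_nonneg hsupp hc₀ v _

theorem IsPreprocessing.welfare_eq (h : IsPreprocessing μ X P)
    (hsupp : ∀ i, ∀ y : ℝ, lo i < y → 0 < μ i {v | (v : ℝ) < y}) (hc₀ : 0 ≤ c₀) {n : ℕ}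
    (hn : n ≠ 0) (v : Profile lo hi) :
    ((tailExp μ (surplus (forwardAlloc X P c₀)) n v : ℝ) : EReal) =
      cumTradeoff μ n (mechState X P c₀ v n) := by
  induction hm : k - n generalizing n v with
  | zero =>
    have hkn := Nat.sub_eq_zero_iff_le.1 hm
    simp [tailExp_of_le _ hkn, cumTradeoff_of_le hkn, terminalTradeoff,
      h.mechState_nonneg hsupp hc₀ v n]
  | succ m ih =>
    have hnk : n < k := by omega
    have := h.welfare_step (c₀ := c₀) ⟨n, hnk⟩ (fun w => ih (Nat.succ_ne_zero n) w (by omega)) v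
    simpa [hn] using this

theorem IsPreprocessing.revenue_forward (h : IsPreprocessing μ X P) (hk : 1 ≤ k)
    (hsupp : ∀ i, ∀ y : ℝ, lo i < y → 0 < μ i {v | (v : ℝ) < y}) (hc₀ : 0 ≤ c₀) :
    (revenue μ (forwardPay X P c₀) : EReal) = cumTradeoff μ 0 c₀ := by
  let v : Profile lo hi := fun i => (nonempty_of_isProbabilityMeasure (μ i)).some
  have := h.welfare_step (c₀ := c₀) ⟨0, hk⟩
    (fun w => h.welfare_eq hsupp hc₀ (Nat.succ_ne_zero 0) w) v
  rw [h.isMechanism_forward.revenue_eq v, h.tailExp_stageUtility_forward hk]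
  simpa [mechState] using this

end Forward

end

theorem theorem3p1 (k : ℕ) (hk : 1 ≤ k) (lo hi : Fin k → ℝ)
    (μ : (i : Fin k) → Measure (Set.Icc (lo i) (hi i))) [∀ i, IsProbabilityMeasure (μ i)]
    (hdens : ∀ i, (μ i).map Subtype.val ≪ (volume : Measure ℝ))
    (hsupp : ∀ i, ∀ y : ℝ, lo i < y → 0 < μ i {v | (v : ℝ) < y}) :
    (∃ X P : (i : Fin k) → ℝ → Set.Icc (lo i) (hi i) → ℝ, IsPreprocessing μ X P) ∧
    (∃ c₀ : ℝ, ∀ c : ℝ, cumTradeoff μ 0 c ≤ cumTradeoff μ 0 c₀) ∧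
    ∀ X P : (i : Fin k) → ℝ → Set.Icc (lo i) (hi i) → ℝ, IsPreprocessing μ X P →
      ∀ c₀ : ℝ, (∀ c : ℝ, cumTradeoff μ 0 c ≤ cumTradeoff μ 0 c₀) →
        IsOptimalMechanism μ (forwardAlloc X P c₀) (forwardPay X P c₀) := by
  have hatom : ∀ i, NullSingletonClass (μ i) := fun i =>
    nullSingletonClass_of_map_absolutelyContinuous (hdens i)
  refine ⟨exists_isPreprocessing hsupp, exists_maximizer_cumTradeoff hk hsupp,
    fun X P hXP c₀ hmax => ?_⟩
  have hreg := regularTradeoff_cumTradeoff (μ := μ) hsupp 0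
  have hc₀ : 0 ≤ c₀ := by
    by_contra hneg
    have h0 := hmax 0
    rw [hreg.eq_bot c₀ (not_le.1 hneg), le_bot_iff] at h0
    exact hreg.ne_bot 0 le_rfl h0
  refine ⟨hXP.feasible_forward hsupp hc₀, fun y q hyq => ?_⟩
  rw [← EReal.coe_le_coe_iff, hXP.revenue_forward hk hsupp hc₀]
  exact (hyq.revenue_le hk fun i => (nonempty_of_isProbabilityMeasure (μ i)).some).trans (hmax _)
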